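/- **Setting.** For $\varepsilon>0$ let $\Omega_\varepsilon=\{(x_1,x_2): |x_2|\le\varepsilon\}$, and let $f_\pm:\mathbb R\to\mathbb R$ be $C^\infty$. A function is *diagonally concave* on $\Omega\subset\Omega_\varepsilon$ if it is concave along every segment contained in $\Omega$ and parallel to one of the directions $x_1\pm x_2=\mathrm{const}$ (diagonal directions). A function $B$ on $\Omega$ is a *Bellman candidate* on $\Omega$ if (1) $B$ is diagonally concave on $\Omega$; (2) $B(x_1,\pm\varepsilon)=f_\pm(x_1)$ whenever $(x_1,\pm\varepsilon)\in\Omega$; (3) for each $y\in\Omega$, either some segment in $\Omega$ of a diagonal direction (possibly degenerate if $|y_2|=\varepsilon$) joins $y$ to a point of $\partial\Omega_\varepsilon$ and $B$ is linear on it, or $B$ is linear in both diagonal directions in a neighbourhood of $y$ in $\Omega$. *Simple foliations.* Put $\Omega_R(u_1,u_2)=\{x\in\Omega_\varepsilon: u_1\le x_1-x_2\le u_2\}$ and $\Omega_L(u_1,u_2)=\{x\in\Omega_\varepsilon: u_1\le x_1+x_2\le u_2\}$, with the standard functions $$B_R(x)=\tfrac{\varepsilon+x_2}{2\varepsilon}f_+(x_1-x_2+\varepsilon)+\tfrac{\varepsilon-x_2}{2\varepsilon}f_-(x_1-x_2-\varepsilon),\qquad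 B_L(x)=\tfrac{\varepsilon+x_2}{2\varepsilon}f_+(x_1+x_2-\varepsilon)+\tfrac{\varepsilon-x_2}{2\varepsilon}f_-(x_1+x_2+\varepsilon).$$ *SW-fissures.* An SW-fissure over $[a,b]$ ($a<b$) is given by a spine function $T\in C^1[a,b]$ with $T(a)=-\varepsilon$, $T(b)=\varepsilon$, $|T|<\varepsilon$ on $(a,b)$, and $|T'|\le1$ with strict inequality except at finitely many points. From each spine point $(u,T(u))$ an upper rib goes to $(u+T(u)-\varepsilon,\varepsilon)$ and a lower rib to $(u-T(u)-\varepsilon,-\varepsilon)$. For $a=v+\varepsilon$, $b=w+\varepsilon$, the union of all ribs is denoted $\Omega_{SW}(v,w)$. Along the spine, $f_\pm$ and their derivatives are evaluated at $u\pm T(u)-\varepsilon$, and $$D_\pm=\frac{f_+'-f_-'}{2T}-f_\pm''.$$ **Proposition.** Assume $f_+'(u_0)=f_-'(u_0)$, $f_+''(u_0)>f_-''(u_0)$ and $f_+'''(u_0)>0$. Then there is $\varepsilon_0>0$ such that for every $\varepsilon\in(0,\varepsilon_0)$ the equation $$f_+'(u+\varepsilon)-f_-'(u-\varepsilon)-2\varepsilon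 f_+''(u+\varepsilon)=0$$ has exactly one root $u_+$ in $(u_0,u_0+2\varepsilon)$, and there are $v_-<u_0-\varepsilon$ and an SW-fissure with spine function $T$ over $[v_-+\varepsilon,u_++\varepsilon]$ such that: * $T(u_0+\varepsilon)=0$, $T(u_++\varepsilon)=\varepsilon$, $T(v_-+\varepsilon)=-\varepsilon$; * at every $u\in[v_-+\varepsilon,u_++\varepsilon]$ other than $u_0+\varepsilon$ and $u_++\varepsilon$ (where the right-hand side below has the form $0/0$) one has $T\ne0$, $D_\pm\ge0$, and $$T'=\frac{(\varepsilon-T)D_--(\varepsilon+T)D_+}{(\varepsilon-T)D_-+(\varepsilon+T)D_+}$$ with nonzero denominator (and a one-sided derivative at the left endpoint); * let $A$ be the continuous function on $[v_-+\varepsilon,u_++\varepsilon]$ given where $T\neq0$ by $$A=\frac{\varepsilon^2-T^2}{2\varepsilon T}\big[(\varepsilon+T)f_+'-(\varepsilon-T)f_-'\big]+\frac{(\varepsilon+T)f_++(\varepsilon-T)f_-}{2\varepsilon}$$ (such a continuous function exists); then the function $B$ defined by $$B(x)=\frac{\varepsilon-x_2}{\varepsilon-T}A+\frac{x_2-T}{\varepsilon-T}f_+\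 \text{ on the upper rib at }u,\qquad B(x)=\frac{\varepsilon+x_2}{\varepsilon+T}A+\frac{T-x_2}{\varepsilon+T}f_-\ \text{ on the lower rib at }u$$ (ribs that degenerate to a point being disregarded) is well defined and is a Bellman candidate on $\Omega_{SW}(v_-,u_+)$; * there is $\delta>0$ (depending on $\varepsilon$) such that $B_R$ is a Bellman candidate on $\Omega_R(u_+,u_++\delta)$, $B_L$ is a Bellman candidate on $\Omega_L(v_--\delta,v_-)$, and the function equal to $B_L$ on $\Omega_L(v_--\delta,v_-)$, to $B$ on $\Omega_{SW}(v_-,u_+)$ and to $B_R$ on $\Omega_R(u_+,u_++\delta)$ is well defined, $C^1$-smooth and a Bellman candidate on the union of these three regions. -/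

import Mathlib

open Set Filter Topology

namespace BellmanStrip

/-- The horizontal strip `{(x₁, x₂) : -ε ≤ x₂ ≤ ε}`. -/
def strip (ε : ℝ) : Set (ℝ × ℝ) := {x | |x.2| ≤ ε}

/-- The points `x`, `y` lie on a common line `x₁ - x₂ = const` or `x₁ + x₂ = const`. -/
def IsDiagonal (x y : ℝ × ℝ) : Prop :=
  x.1 - x.2 = y.1 - y.2 ∨ x.1 + x.2 = y.1 + y.2

/-- `B` is linear (affine) along the segment from `x` to `y`. -/
def LinearOnSegment (B : ℝ × ℝ → ℝ) (x y : ℝ × ℝ) : Prop :=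
  ∀ t ∈ Icc (0 : ℝ) 1, B ((1 - t) • x + t • y) = (1 - t) * B x + t * B y

/-- Diagonal concavity on `Ω`: concavity along every segment contained in `Ω` and parallel to
one of the directions `x₁ ± x₂ = const`. -/
def DiagonallyConcaveOn (Ω : Set (ℝ × ℝ)) (B : ℝ × ℝ → ℝ) : Prop :=
  ∀ x y : ℝ × ℝ, IsDiagonal x y → segment ℝ x y ⊆ Ω → ConcaveOn ℝ (segment ℝ x y) B

/-- Bellman candidate on a subregion `Ω` of the strip, with boundary values `fp` on the upper
boundary line `x₂ = ε` and `fm` on the lower one `x₂ = -ε`. In `extremal` the segment may be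
degenerate only if `y` itself lies on the boundary of the strip. -/
structure IsBellmanCandidate (ε : ℝ) (fp fm : ℝ → ℝ) (Ω : Set (ℝ × ℝ)) (B : ℝ × ℝ → ℝ) :
    Prop where
  subset_strip : Ω ⊆ strip ε
  concave : DiagonallyConcaveOn Ω B
  boundary_upper : ∀ x ∈ Ω, x.2 = ε → B x = fp x.1
  boundary_lower : ∀ x ∈ Ω, x.2 = -ε → B x = fm x.1
  extremal : ∀ y ∈ Ω,
    (∃ z : ℝ × ℝ, (z.2 = ε ∨ z.2 = -ε) ∧ IsDiagonal y z ∧ segment ℝ y z ⊆ Ω ∧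
      LinearOnSegment B y z) ∨
    (∃ U ∈ 𝓝 y, ∀ p q : ℝ × ℝ, IsDiagonal p q → segment ℝ p q ⊆ U ∩ Ω →
      LinearOnSegment B p q)

/-! ### Simple foliations -/

/-- The region foliated by the right extremal segments `x₁ - x₂ = u`, `u₁ ≤ u ≤ u₂`. -/
def regionR (ε u₁ u₂ : ℝ) : Set (ℝ × ℝ) := {x ∈ strip ε | x.1 - x.2 ∈ Icc u₁ u₂}

/-- The region foliated by the left extremal segments `x₁ + x₂ = u`, `u₁ ≤ u ≤ u₂`. -/
def regionL (ε u₁ u₂ : ℝ) : Set (ℝ × ℝ) := {x ∈ strip ε | x.1 + x.2 ∈ Icc u₁ u₂}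

/-- The standard function that is linear along the right extremal segments. -/
noncomputable def candidateR (ε : ℝ) (fp fm : ℝ → ℝ) (x : ℝ × ℝ) : ℝ :=
  (ε + x.2) / (2 * ε) * fp (x.1 - x.2 + ε) + (ε - x.2) / (2 * ε) * fm (x.1 - x.2 - ε)

/-- The standard function that is linear along the left extremal segments. -/
noncomputable def candidateL (ε : ℝ) (fp fm : ℝ → ℝ) (x : ℝ × ℝ) : ℝ :=
  (ε + x.2) / (2 * ε) * fp (x.1 + x.2 - ε) + (ε - x.2) / (2 * ε) * fm (x.1 + x.2 + ε)

/-! ### Left horizontal herringbones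

The spine is the graph of `T` over `[a, b]`. From each point `(u, T u)` one rib goes to the point
`(u + T u - ε, ε)` of the upper boundary, another one to `(u - T u - ε, -ε)` on the lower one. -/

/-- The upper rib at `u`. -/
def upperRib (ε : ℝ) (T : ℝ → ℝ) (u : ℝ) : Set (ℝ × ℝ) :=
  {x | x.1 + x.2 = u + T u ∧ T u ≤ x.2 ∧ x.2 ≤ ε}

/-- The lower rib at `u`. -/
def lowerRib (ε : ℝ) (T : ℝ → ℝ) (u : ℝ) : Set (ℝ × ℝ) :=
  {x | x.1 - x.2 = u - T u ∧ -ε ≤ x.2 ∧ x.2 ≤ T u}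

/-- The region foliated by the ribs of the left herringbone with spine `T` over `[a, b]`. -/
def regionHerringbone (ε : ℝ) (T : ℝ → ℝ) (a b : ℝ) : Set (ℝ × ℝ) :=
  ⋃ u ∈ Icc a b, upperRib ε T u ∪ lowerRib ε T u

/-- `T` is the spine of a left herringbone over `[a, b]`: a `C¹` function whose graph lies in the
strip, with `|T'| ≤ 1` and with strict inequality off a finite set. -/
structure IsLeftSpine (ε : ℝ) (T : ℝ → ℝ) (a b : ℝ) : Prop where
  lt : a < b
  contDiffOn : ContDiffOn ℝ 1 T (Icc a b)
  mem_strip : ∀ u ∈ Icc a b, |T u| ≤ ε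
  abs_deriv_le : ∀ u ∈ Icc a b, |derivWithin T (Icc a b) u| ≤ 1
  finite_abs_deriv_eq : {u ∈ Icc a b | |derivWithin T (Icc a b) u| = 1}.Finite

/-- `T` is the spine of an SW-fissure over `[a, b]`: a left herringbone going from the lower
boundary of the strip to the upper one. -/
structure IsSWFissure (ε : ℝ) (T : ℝ → ℝ) (a b : ℝ) : Prop extends IsLeftSpine ε T a b where
  left_end : T a = -ε
  right_end : T b = ε
  interior : ∀ u ∈ Ioo a b, |T u| < ε

/-- `D₊` at the point `(u, t)` of the spine (`t ≠ 0`). -/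
noncomputable def DLp (ε : ℝ) (fp fm : ℝ → ℝ) (u t : ℝ) : ℝ :=
  (deriv fp (u + t - ε) - deriv fm (u - t - ε)) / (2 * t) - iteratedDeriv 2 fp (u + t - ε)

/-- `D₋` at the point `(u, t)` of the spine (`t ≠ 0`). -/
noncomputable def DLm (ε : ℝ) (fp fm : ℝ → ℝ) (u t : ℝ) : ℝ :=
  (deriv fp (u + t - ε) - deriv fm (u - t - ε)) / (2 * t) - iteratedDeriv 2 fm (u - t - ε)

/-- Numerator of the right-hand side of the differential equation of the spine. -/
noncomputable def odeNum (ε : ℝ) (fp fm : ℝ → ℝ) (u t : ℝ) : ℝ :=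
  (ε - t) * DLm ε fp fm u t - (ε + t) * DLp ε fp fm u t

/-- Denominator of the right-hand side of the differential equation of the spine. -/
noncomputable def odeDen (ε : ℝ) (fp fm : ℝ → ℝ) (u t : ℝ) : ℝ :=
  (ε - t) * DLm ε fp fm u t + (ε + t) * DLp ε fp fm u t

/-- `T` solves the differential equation
`T' = ((ε - T) D₋ - (ε + T) D₊) / ((ε - T) D₋ + (ε + T) D₊)`, with `D₊ ≥ 0` and `D₋ ≥ 0`, on
`[a, b]` outside the set `S` of the parameters of stationary points (where the right-hand side
has the form `0/0`). Outside `S` the right-hand side is required to be meaningful; the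
derivatives at `a` and `b` are one-sided. -/
def SolvesLeftSpineODE (ε : ℝ) (fp fm : ℝ → ℝ) (T : ℝ → ℝ) (a b : ℝ) (S : Set ℝ) : Prop :=
  ∀ u ∈ Icc a b \ S,
    T u ≠ 0 ∧ 0 ≤ DLp ε fp fm u (T u) ∧ 0 ≤ DLm ε fp fm u (T u) ∧
    odeDen ε fp fm u (T u) ≠ 0 ∧
    HasDerivWithinAt T (odeNum ε fp fm u (T u) / odeDen ε fp fm u (T u)) (Icc a b) u

/-- `A` is the function of values on the spine: it is given by the explicit formula wherever
`T ≠ 0`, and by continuity at the points where `T` vanishes. -/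
def IsSpineValue (ε : ℝ) (fp fm : ℝ → ℝ) (T : ℝ → ℝ) (a b : ℝ) (A : ℝ → ℝ) : Prop :=
  ContinuousOn A (Icc a b) ∧
  ∀ u ∈ Icc a b, T u ≠ 0 →
    A u = (ε ^ 2 - T u ^ 2) / (2 * ε * T u) *
        ((ε + T u) * deriv fp (u + T u - ε) - (ε - T u) * deriv fm (u - T u - ε))
      + ((ε + T u) * fp (u + T u - ε) + (ε - T u) * fm (u - T u - ε)) / (2 * ε)

/-- `B` is given on the ribs of the herringbone by linear interpolation between the value `A` on
the spine and the boundary values. A rib is skipped only if it degenerates to a single point,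
which then belongs to the other rib at the same `u`. -/
def IsHerringboneFunction (ε : ℝ) (fp fm : ℝ → ℝ) (T A : ℝ → ℝ) (a b : ℝ)
    (B : ℝ × ℝ → ℝ) : Prop :=
  ∀ u ∈ Icc a b,
    (T u < ε → ∀ x ∈ upperRib ε T u,
      B x = (ε - x.2) / (ε - T u) * A u + (x.2 - T u) / (ε - T u) * fp (u + T u - ε)) ∧
    (-ε < T u → ∀ x ∈ lowerRib ε T u,
      B x = (ε + x.2) / (ε + T u) * A u + (T u - x.2) / (ε + T u) * fm (u - T u - ε))

end BellmanStrip

namespace BellmanStrip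

/-! ### A singular initial value problem -/

/-! Parametrizing the spine by its height `t` removes the singularity at `T = 0` and tames the one
at `T = ε`. Write `φ = f₊'`, `ψ = f₋'`, and let `q(t)` and `q(t) + 2t` be the ends of the lower and
upper rib at height `t`, so that `u = q + t + ε`. Put `r = q'` and `m = (φ(q + 2t) - ψ(q)) / (2t)`;
then `D₊ = m - φ'(q + 2t)` and `D₋ = m - ψ'(q)`. With `D₊ = (ε - t) g`, the equation of the spine
reads `r D₋ = (2 + r)(ε + t) g`. Differentiating `2 t m = φ - ψ` along it gives `m' = (2 + r) g`:
the factor `2t` cancels and `t = 0` is no longer singular. Substituting `m = (ε - t) g + φ'` yields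
`(ε - t) g' = 3 g - (2 φ'' - r (g - φ''))` with `φ''` taken at `q + 2t`. This is singular only at `t
= ε`, and an explicit integral selects the solution that is regular there.

After the scaling `t = ε y`, `q = u₀ + ε z` the system is, for small `ε`, a small Lipschitz
perturbation of `r = 0`, `(1 - y) g' = 3 g - 2 φ''(u₀)`, and is solved by a contraction
(`exists_singular_system`, `exists_isSpineFlow`). The hypothesis `f₊''' > 0` gives `g > 0`, hence
`D₊ ≥ 0`; `f₊'' > f₋''` gives `D₋ > 0`; equality of the first derivatives makes `2 t m = φ - ψ` hold
at `t = 0`. At `t = ε` one gets `D₊ = 0`, which is the equation for `u₊ = q(ε) + ε`.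

The candidate is one function `glued` on the whole strip, linear along left diagonals on one side of
the spine and along right diagonals on the other. Its slopes are primitives of a function equal to
`m` at the rib ends and to the corresponding difference quotient beyond them, so `B_L` and `B_R` are
restrictions of it (`exists_upper_slope`, `exists_lower_slope`). The two halves fit in a `C¹` way,
so diagonal concavity means that the directional derivative is monotone along each diagonal. On one
side of the spine it is constant; on the other its rate of change has a sign because `g > 0`
(`lowerTheta_spine`, `upperTheta_spine`) or, over the simple foliations, because `D₊, D₋ ≥ 0` there
(`exists_extendsBy`). -/

/-- The solution of `(1 - y) g' = 3 g - q` that is regular at `y = 1`. -/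
noncomputable def regularSolution (q : ℝ → ℝ) (y : ℝ) : ℝ :=
  ∫ l in (0 : ℝ)..1, l ^ 2 * q (1 - l * (1 - y))

lemma continuous_regularSolution {q : ℝ → ℝ} (hq : Continuous q) :
    Continuous (regularSolution q) := by
  unfold regularSolution
  apply intervalIntegral.continuous_parametric_intervalIntegral_of_continuous'
  fun_prop

/-- Substitute `w = 1 - l (1 - y)`. The right side is the equation integrated with the factor `(1 -
y) ^ 2` from the singular point, which excludes the homogeneous solution `(1 - y) ^ (-3)`. -/
lemma regularSolution_eq (q : ℝ → ℝ) (y : ℝ) :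
    (1 - y) ^ 3 * regularSolution q y = ∫ w in y..1, (1 - w) ^ 2 * q w := by
  have h := intervalIntegral.mul_integral_comp_sub_mul (a := 0) (b := 1)
    (f := fun w => (1 - w) ^ 2 * q w) (1 - y) 1
  simp only [mul_zero, sub_zero, mul_one, sub_sub_cancel] at h
  rw [← h, regularSolution, ← intervalIntegral.integral_const_mul,
    ← intervalIntegral.integral_const_mul]
  refine intervalIntegral.integral_congr fun l _ => ?_
  rw [mul_comm l]
  ring

lemma hasDerivAt_regularSolution {q : ℝ → ℝ} (hq : Continuous q) {y : ℝ} (hy : y ≠ 1) :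
    HasDerivAt (regularSolution q) ((3 * regularSolution q y - q y) / (1 - y)) y := by
  have hy' : 1 - y ≠ 0 := sub_ne_zero.mpr hy.symm
  have hc : Continuous fun w => (1 - w) ^ 2 * q w := by fun_prop
  have h1 : HasDerivAt (fun y => ∫ w in y..1, (1 - w) ^ 2 * q w) (-((1 - y) ^ 2 * q y)) y :=
    intervalIntegral.integral_hasDerivAt_left (hc.intervalIntegrable _ _)
      (hc.stronglyMeasurableAtFilter _ _) hc.continuousAt
  have h2 : HasDerivAt (fun y : ℝ => (1 - y) ^ 3) (3 * (1 - y) ^ 2 * (-1)) y := by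
    exact (((hasDerivAt_id y).const_sub 1).pow 3).congr_deriv (by simp)
  have h3 := h1.div h2 (pow_ne_zero 3 hy')
  have h4 : regularSolution q =ᶠ[𝓝 y]
      (fun y => ∫ w in y..1, (1 - w) ^ 2 * q w) / fun y : ℝ => (1 - y) ^ 3 := by
    filter_upwards [isOpen_ne.mem_nhds hy] with w hw
    have hw' : 1 - w ≠ 0 := sub_ne_zero.mpr (Ne.symm hw)
    simp only [Pi.div_apply, ← regularSolution_eq]
    field_simp
  refine (h3.congr_of_eventuallyEq h4).congr_deriv ?_
  rw [← regularSolution_eq]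
  field_simp
  ring

/-- Only values on `[y, 1]` enter, with the weight `l ^ 2` of mass `1 / 3`. The cruder constant 1
suffices, since the contraction factor will come from the Lipschitz constant of the data. -/
lemma abs_regularSolution_sub_le {q r : ℝ → ℝ} (hq : Continuous q) (hr : Continuous r) {C y : ℝ}
    (hy : y ≤ 1) (h : ∀ w ∈ Icc y 1, |q w - r w| ≤ C) :
    |regularSolution q y - regularSolution r y| ≤ C := by
  unfold regularSolution
  rw [← intervalIntegral.integral_sub]
  · have := intervalIntegral.norm_integral_le_of_norm_le_const (a := 0) (b := 1) (C := C)
      (f := fun l => l ^ 2 * q (1 - l * (1 - y)) - l ^ 2 * r (1 - l * (1 - y))) (by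
        intro l hl
        rw [uIoc_of_le zero_le_one] at hl
        rw [← mul_sub, Real.norm_eq_abs, abs_mul, abs_of_nonneg (sq_nonneg l)]
        have h1 := h (1 - l * (1 - y)) ⟨by nlinarith [hl.1, hl.2], by nlinarith [hl.1, hl.2]⟩
        have h2 : l ^ 2 ≤ 1 := by nlinarith [hl.1, hl.2]
        nlinarith [abs_nonneg (q (1 - l * (1 - y)) - r (1 - l * (1 - y)))])
    simpa using this
  · exact Continuous.intervalIntegrable (by fun_prop) _ _
  · exact Continuous.intervalIntegrable (by fun_prop) _ _

lemma regularSolution_const (k y : ℝ) : regularSolution (fun _ => k) y = k / 3 := by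
  simp [regularSolution]
  norm_num
  ring

/-- The singular system `z' = F (y, g, z)`, `(1 - y) g' = 3 g - Q (y, g, z)` with `z 0 = 0` has a
solution on `[-1, 1]` that is regular at `y = 1`. -/
lemma exists_singular_system {F Q : ℝ × ℝ × ℝ → ℝ} (hF : LipschitzWith (1 / 2) F)
    (hQ : LipschitzWith (1 / 2) Q) :
    ∃ g z Fh Qh : ℝ → ℝ, Continuous g ∧ Continuous Fh ∧ Continuous Qh ∧ z 0 = 0 ∧
      (∀ y, HasDerivAt z (Fh y) y) ∧ (∀ y, g y = regularSolution Qh y) ∧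
      (∀ y, Fh y ∈ range F) ∧ (∀ y, Qh y ∈ range Q) ∧
      ∀ y ∈ Icc (-1 : ℝ) 1, Fh y = F (y, g y, z y) ∧ Qh y = Q (y, g y, z y) := by
  -- Freezing the data outside `[-1, 1]` makes all functions globally defined; the equations are
  -- claimed on `[-1, 1]` only.
  let π : ℝ → Icc (-1 : ℝ) 1 := projIcc (-1) 1 (by norm_num)
  have hπ : Continuous π := continuous_projIcc
  let Fc (X : C(Icc (-1 : ℝ) 1, ℝ × ℝ)) (y : ℝ) : ℝ := F (π y, X (π y))
  let Qc (X : C(Icc (-1 : ℝ) 1, ℝ × ℝ)) (y : ℝ) : ℝ := Q (π y, X (π y))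
  have hFc : ∀ X, Continuous (Fc X) := fun X => hF.continuous.comp (by fun_prop)
  have hQc : ∀ X, Continuous (Qc X) := fun X => hQ.continuous.comp (by fun_prop)
  let Φ (X : C(Icc (-1 : ℝ) 1, ℝ × ℝ)) : C(Icc (-1 : ℝ) 1, ℝ × ℝ) :=
    { toFun := fun y => (regularSolution (Qc X) y, ∫ w in (0 : ℝ)..y, Fc X w)
      continuous_toFun := by
        have h1 := continuous_regularSolution (hQc X)
        have h2 : Continuous fun y : ℝ => ∫ w in (0 : ℝ)..y, Fc X w :=
          intervalIntegral.continuous_primitive (fun a b => (hFc X).intervalIntegrable a b) 0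
        exact (h1.comp continuous_subtype_val).prodMk (h2.comp continuous_subtype_val) }
  have key : ∀ (R : ℝ × ℝ × ℝ → ℝ), LipschitzWith (1 / 2) R →
      ∀ X Y : C(Icc (-1 : ℝ) 1, ℝ × ℝ), ∀ w : ℝ,
        |R (π w, X (π w)) - R (π w, Y (π w))| ≤ 1 / 2 * dist X Y := by
    intro R hR X Y w
    have h1 := hR.dist_le_mul ((π w : ℝ), X (π w)) ((π w : ℝ), Y (π w))
    rw [Real.dist_eq, Prod.dist_eq] at h1
    simp only [dist_self] at h1
    rw [max_eq_right dist_nonneg] at h1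
    have h2 := ContinuousMap.dist_apply_le_dist (f := X) (g := Y) (π w)
    refine h1.trans ?_
    have : ((1 / 2 : NNReal) : ℝ) = 1 / 2 := by norm_num
    rw [this]
    linarith
  -- Neither integral operator increases the sup norm on `[-1, 1]`, so the factor `1 / 2` of `F` and
  -- `Q` passes to `Φ` without shortening the interval.
  have hΦ : ContractingWith (1 / 2) Φ := by
    refine ⟨by rw [← NNReal.coe_lt_coe]; norm_num, LipschitzWith.of_dist_le_mul fun X Y => ?_⟩
    have h12 : ((1 / 2 : NNReal) : ℝ) = 1 / 2 := by norm_num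
    rw [h12]
    have h0 : 0 ≤ 1 / 2 * dist X Y := by positivity
    rw [ContinuousMap.dist_le h0]
    intro y
    rw [Prod.dist_eq, max_le_iff, Real.dist_eq, Real.dist_eq]
    constructor
    · exact abs_regularSolution_sub_le (hQc X) (hQc Y) y.2.2 fun w _ => key Q hQ X Y w
    · change |(∫ w in (0 : ℝ)..y, Fc X w) - ∫ w in (0 : ℝ)..y, Fc Y w| ≤ _
      rw [← intervalIntegral.integral_sub ((hFc X).intervalIntegrable _ _)
        ((hFc Y).intervalIntegrable _ _)]
      have := intervalIntegral.norm_integral_le_of_norm_le_const (a := 0) (b := (y : ℝ))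
        (C := 1 / 2 * dist X Y) (f := fun w => Fc X w - Fc Y w) fun w _ => key F hF X Y w
      have hy : |(y : ℝ) - 0| ≤ 1 := by
        rw [sub_zero]; exact abs_le.mpr y.2
      refine this.trans ?_
      nlinarith
  obtain ⟨X, hX⟩ : ∃ X, Φ X = X := ⟨_, hΦ.fixedPoint_isFixedPt⟩
  have hX1 : ∀ y : Icc (-1 : ℝ) 1,
      X y = (regularSolution (Qc X) y, ∫ w in (0 : ℝ)..y, Fc X w) := by
    intro y
    conv_lhs => rw [← hX]
    rfl
  refine ⟨regularSolution (Qc X), fun y => ∫ w in (0 : ℝ)..y, Fc X w, Fc X, Qc X,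
    continuous_regularSolution (hQc X), hFc X, hQc X, by simp,
    fun y => ((hFc X).integral_hasStrictDerivAt 0 y).hasDerivAt, fun y => rfl,
    fun y => mem_range_self _, fun y => mem_range_self _, fun y hy => ?_⟩
  have hy' : π y = ⟨y, hy⟩ := projIcc_of_mem _ hy
  constructor
  · change F (π y, X (π y)) = _
    rw [hy', hX1]
  · change Q (π y, X (π y)) = _
    rw [hy', hX1]

/-- A function of `(ε, x)` that is `C¹` near `{0} × K` and vanishes at `ε = 0` is small and has a
small Lipschitz constant in `x ∈ K` when `ε` is small. -/
lemma exists_small_lipschitz {E : Type*} [NormedAddCommGroup E] [NormedSpace ℝ E]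
    {F : ℝ × E → ℝ} {K : Set E} (hK : IsCompact K) (hKc : Convex ℝ K)
    (hF : ∀ x ∈ K, ContDiffAt ℝ 1 F (0, x)) (h0 : ∀ x, F (0, x) = 0) {τ : ℝ} (hτ : 0 < τ) :
    ∃ ε₀ > 0, ∀ ε : ℝ, |ε| < ε₀ →
      (∀ x ∈ K, |F (ε, x)| ≤ τ) ∧ LipschitzOnWith τ.toNNReal (fun x => F (ε, x)) K := by
  have hev : ∀ x ∈ K, ∀ᶠ w in 𝓝 ((0 : ℝ), x), |F w| < τ ∧ DifferentiableAt ℝ F w ∧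
      ‖(fderiv ℝ F w).comp (ContinuousLinearMap.inr ℝ ℝ E)‖ < τ := by
    intro x hx
    have hd := hF x hx
    have h1 : ∀ᶠ w in 𝓝 ((0 : ℝ), x), |F w| < τ := by
      have : ContinuousAt (fun w => |F w|) ((0 : ℝ), x) := hd.continuousAt.abs
      refine this.eventually_lt_const ?_
      simpa [h0] using hτ
    have h2 : ∀ᶠ w in 𝓝 ((0 : ℝ), x), DifferentiableAt ℝ F w := by
      filter_upwards [hd.eventually (by simp)] with w hw
      exact hw.differentiableAt (by simp)
    have h3 : ContinuousAt
        (fun w => ‖(fderiv ℝ F w).comp (ContinuousLinearMap.inr ℝ ℝ E)‖) ((0 : ℝ), x) := by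
      have h : ContinuousAt (fderiv ℝ F) ((0 : ℝ), x) :=
        (hd.fderiv_right (m := 0) (by simp)).continuousAt
      exact (h.clm_comp continuousAt_const).norm
    -- `F` vanishes on the slice `ε = 0`, hence so does its derivative in the directions of that
    -- slice.
    have h4 : (fderiv ℝ F (0, x)).comp (ContinuousLinearMap.inr ℝ ℝ E) = 0 := by
      have hc : HasFDerivAt (fun y : E => ((0 : ℝ), y)) (ContinuousLinearMap.inr ℝ ℝ E) x :=
        (ContinuousLinearMap.inr ℝ ℝ E).hasFDerivAt
      have h5 : HasFDerivAt (fun y : E => F (0, y))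
          ((fderiv ℝ F (0, x)).comp (ContinuousLinearMap.inr ℝ ℝ E)) x :=
        (hd.differentiableAt (by simp)).hasFDerivAt.comp x hc
      have h6 : HasFDerivAt (fun y : E => F (0, y)) (0 : E →L[ℝ] ℝ) x := by
        simp only [h0]
        exact hasFDerivAt_const 0 x
      exact h5.unique h6
    have h5 := h3.tendsto.eventually_lt_const (u := τ) (by rw [h4]; simpa using hτ)
    filter_upwards [h1, h2, h5] with w a b c using ⟨a, b, c⟩
  let S : Set (ℝ × E) := {w | |F w| < τ ∧ DifferentiableAt ℝ F w ∧
      ‖(fderiv ℝ F w).comp (ContinuousLinearMap.inr ℝ ℝ E)‖ < τ}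
  -- Compactness of `K` turns the pointwise neighbourhoods into one range of `ε` valid for all `x ∈
  -- K`.
  obtain ⟨u, v, hu, -, h0u, hKv, huv⟩ := generalized_tube_lemma (isCompact_singleton (x := (0 : ℝ)))
    hK (isOpen_interior (s := S)) (by
      rintro ⟨e, x⟩ ⟨he, hx⟩
      obtain rfl : e = 0 := he
      exact mem_interior_iff_mem_nhds.mpr (hev x hx))
  obtain ⟨r, hr, hru⟩ := Metric.isOpen_iff.mp hu 0 (h0u rfl)
  refine ⟨r, hr, fun ε hε => ?_⟩
  have hS : ∀ x ∈ K, (ε, x) ∈ S := fun x hx =>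
    interior_subset (huv ⟨hru (by simpa using hε), hKv hx⟩)
  refine ⟨fun x hx => (hS x hx).1.le, ?_⟩
  refine Convex.lipschitzOnWith_of_nnnorm_hasFDerivWithin_le (𝕜 := ℝ)
    (f' := fun x => (fderiv ℝ F (ε, x)).comp (ContinuousLinearMap.inr ℝ ℝ E))
    (fun x hx => HasFDerivAt.hasFDerivWithinAt ?_) (fun x hx => ?_) hKc
  · have hc : HasFDerivAt (fun y : E => (ε, y)) (ContinuousLinearMap.inr ℝ ℝ E) x := by
      exact hasFDerivAt_prodMk_right ε x
    exact (hS x hx).2.1.hasFDerivAt.comp x hc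
  · rw [← NNReal.coe_le_coe, Real.coe_toNNReal _ hτ.le]
    exact (hS x hx).2.2.le

/-! ### The spine as a regular flow in the height variable -/

/-- The spine of the fissure parametrized by its height `t`: the boundary points at the ends of
the ribs are `q t + 2 t` (above) and `q t` (below), `m` is the common value
`(φ (q + 2 t) - ψ q) / (2 t)`, and `D₊ = (ε - t) g`. -/
structure IsSpineFlow (ε : ℝ) (φ ψ : ℝ → ℝ) (u₀ : ℝ) (q r m g : ℝ → ℝ) : Prop where
  continuous_r : Continuous r
  abs_r_le : ∀ t, |r t| ≤ 1 / 2
  hasDerivAt_q : ∀ t, HasDerivAt q (r t) t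
  q_zero : q 0 = u₀
  abs_q_sub_le : ∀ t ∈ Icc (-ε) ε, |q t - u₀| ≤ ε / 2
  continuous_m : Continuous m
  hasDerivAt_m : ∀ t ∈ Ico (-ε) ε, HasDerivAt m ((2 + r t) * g t) t
  m_eq : ∀ t, m t = (ε - t) * g t + deriv φ (q t + 2 * t)
  g_pos : ∀ t ∈ Icc (-ε) ε, 0 < g t
  lt_m : ∀ t ∈ Icc (-ε) ε, deriv ψ (q t) < m t
  r_mul : ∀ t ∈ Icc (-ε) ε, r t * (m t - deriv ψ (q t)) = (2 + r t) * ((ε + t) * g t)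

lemma lipschitzWith_max_min {a b : ℝ} : LipschitzWith 1 fun x : ℝ => max a (min b x) :=
  (LipschitzWith.id.const_min b).const_max a

/-- Existence of the spine for small `ε`. -/
lemma exists_isSpineFlow {φ ψ : ℝ → ℝ} (hφ : ContDiff ℝ (⊤ : ℕ∞) φ) (hψ : ContDiff ℝ (⊤ : ℕ∞) ψ)
    (u₀ : ℝ) (h1 : deriv ψ u₀ < deriv φ u₀) (h2 : 0 < deriv (deriv φ) u₀) :
    ∃ ε₀ > 0, ∀ ε : ℝ, 0 < ε → ε < ε₀ → ∃ q r m g, IsSpineFlow ε φ ψ u₀ q r m g := by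
  have hφ1 : ContDiff ℝ (⊤ : ℕ∞) (deriv φ) := by
    simpa using hφ.iterate_deriv 1
  have hφ2 : ContDiff ℝ (⊤ : ℕ∞) (deriv (deriv φ)) := by
    simpa using hφ.iterate_deriv 2
  have hψ1 : ContDiff ℝ (⊤ : ℕ∞) (deriv ψ) := by
    simpa using hψ.iterate_deriv 1
  set d := deriv φ u₀ - deriv ψ u₀ with hd
  set c := deriv (deriv φ) u₀ with hc
  have hd0 : 0 < d := sub_pos.mpr h1
  -- The limit `ε = 0` has the solution `g = 2 c / 3`, `z = 0`, which is the centre of the last two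
  -- factors.
  let K : Set (ℝ × ℝ × ℝ) := Icc (-1) 1 ×ˢ Icc (c / 3) c ×ˢ Icc (-1 / 2) (1 / 2)
  have hK : IsCompact K := isCompact_Icc.prod (isCompact_Icc.prod isCompact_Icc)
  have hKc : Convex ℝ K := (convex_Icc _ _).prod ((convex_Icc _ _).prod (convex_Icc _ _))
  -- In the variables `(ε, y, g, z)`: `H` is `D₋`, `F` is `r` solved from `r D₋ = (2 + r)(ε + t) g`,
  -- `P` is `φ''` at the upper rib end, and `Q` is the forcing term in `(1 - y) g' = 3 g - Q`.
  let H : ℝ × ℝ × ℝ × ℝ → ℝ := fun w => w.1 * (1 - w.2.1) * w.2.2.1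
    + deriv φ (u₀ + w.1 * w.2.2.2 + 2 * (w.1 * w.2.1)) - deriv ψ (u₀ + w.1 * w.2.2.2)
  let N : ℝ × ℝ × ℝ × ℝ → ℝ := fun w => H w - w.1 * (1 + w.2.1) * w.2.2.1
  let F : ℝ × ℝ × ℝ × ℝ → ℝ := fun w => 2 * (w.1 * (1 + w.2.1) * w.2.2.1) / N w
  let P : ℝ × ℝ × ℝ × ℝ → ℝ := fun w => deriv (deriv φ) (u₀ + w.1 * w.2.2.2 + 2 * (w.1 * w.2.1))
  let Q : ℝ × ℝ × ℝ × ℝ → ℝ := fun w => 2 * P w - F w * (w.2.2.1 - P w)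
  have hHc : ContDiff ℝ 1 H := by
    have a1 : ContDiff ℝ 1 (deriv φ) := hφ1.of_le (by exact_mod_cast le_top)
    have a2 : ContDiff ℝ 1 (deriv ψ) := hψ1.of_le (by exact_mod_cast le_top)
    fun_prop
  have hNc : ContDiff ℝ 1 N := by fun_prop
  have hPc : ContDiff ℝ 1 P := by
    have a1 : ContDiff ℝ 1 (deriv (deriv φ)) := hφ2.of_le (by exact_mod_cast le_top)
    fun_prop
  have hN0 : ∀ x, N (0, x) = d := fun x => by simp [N, H, hd]
  have hFc : ∀ x, ContDiffAt ℝ 1 F (0, x) := fun x =>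
    ContDiffAt.div (by fun_prop) hNc.contDiffAt (by rw [hN0]; exact hd0.ne')
  have hQc : ∀ x, ContDiffAt ℝ 1 Q (0, x) := fun x => by
    have := hFc x
    fun_prop
  have hF0 : ∀ x, F (0, x) = 0 := fun x => by simp [F]
  have hQ0 : ∀ x, Q (0, x) = 2 * c := fun x => by simp only [Q, hF0]; simp [P, hc]
  obtain ⟨e1, he1, hH⟩ := exists_small_lipschitz (F := fun w => H w - d) hK hKc
    (fun x _ => by fun_prop) (fun x => by simp [H, hd]) (half_pos hd0)
  obtain ⟨e2, he2, hN⟩ := exists_small_lipschitz (F := fun w => N w - d) hK hKc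
    (fun x _ => by fun_prop) (fun x => by rw [hN0]; ring) (half_pos hd0)
  obtain ⟨e3, he3, hF⟩ := exists_small_lipschitz (F := F) hK hKc
    (fun x _ => hFc x) hF0 (one_half_pos)
  obtain ⟨e4, he4, hQ⟩ := exists_small_lipschitz (F := fun w => Q w - 2 * c) hK hKc
    (fun x _ => (hQc x).sub contDiffAt_const) (fun x => by rw [hQ0]; ring)
    -- The bound `1 / 2` serves the contraction; `c / 3` keeps `g` within `c / 3` of `2 c / 3`,
    -- hence positive.
    (lt_min one_half_pos (div_pos h2 three_pos))
  refine ⟨min (min e1 e2) (min e3 e4), by positivity, fun ε hε hε0 => ?_⟩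
  rw [← abs_of_pos hε] at hε0
  simp only [lt_min_iff] at hε0
  have hH := (hH ε hε0.1.1).1
  have hN := (hN ε hε0.1.2).1
  have hF := hF ε hε0.2.1
  have hQ := hQ ε hε0.2.2
  have h12 : (1 / 2 : ℝ).toNNReal = 1 / 2 := by
    ext
    rw [Real.coe_toNNReal _ (by norm_num)]
    norm_num
  have hF2 : LipschitzOnWith (1 / 2) (fun x => F (ε, x)) K := h12 ▸ hF.2
  have hQ2 : LipschitzOnWith (1 / 2) (fun x => Q (ε, x)) K := by
    intro x hx y hy
    have := hQ.2.weaken (h12 ▸ Real.toNNReal_le_toNNReal (min_le_left _ _)) hx hy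
    simpa [edist_dist, Real.dist_eq] using this
  -- Retracting onto the box makes the Lipschitz bounds global. The a priori bounds `hgb` and `hzb`
  -- then show that the solution stays in the box, so the retraction changes nothing.
  let π : ℝ × ℝ × ℝ → ℝ × ℝ × ℝ := fun x =>
    (max (-1) (min 1 x.1), max (c / 3) (min c x.2.1), max (-1 / 2) (min (1 / 2) x.2.2))
  have hπK : ∀ x, π x ∈ K := fun x =>
    ⟨⟨le_max_left _ _, max_le (by norm_num) (min_le_left _ _)⟩,
      ⟨le_max_left _ _, max_le (by linarith) (min_le_left _ _)⟩,
      ⟨le_max_left _ _, max_le (by norm_num) (min_le_left _ _)⟩⟩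
  have hπ : LipschitzWith 1 π := by
    have h1 : LipschitzWith 1 fun x : ℝ × ℝ × ℝ => max (-1) (min 1 x.1) := by
      simpa [Function.comp_def] using lipschitzWith_max_min.comp (LipschitzWith.prod_fst (α := ℝ) (β := ℝ × ℝ))
    have h2 : LipschitzWith 1 fun x : ℝ × ℝ × ℝ => max (c / 3) (min c x.2.1) := by
      simpa [Function.comp_def] using (lipschitzWith_max_min.comp (LipschitzWith.prod_fst (α := ℝ) (β := ℝ))).comp
        (LipschitzWith.prod_snd (α := ℝ) (β := ℝ × ℝ))
    have h3 : LipschitzWith 1 fun x : ℝ × ℝ × ℝ => max (-1 / 2) (min (1 / 2) x.2.2) := by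
      simpa [Function.comp_def] using (lipschitzWith_max_min.comp (LipschitzWith.prod_snd (α := ℝ) (β := ℝ))).comp
        (LipschitzWith.prod_snd (α := ℝ) (β := ℝ × ℝ))
    simpa [π] using h1.prodMk (h2.prodMk h3)
  have hπ1 : ∀ x ∈ K, π x = x := by
    rintro ⟨y, g, z⟩ ⟨hy, hg, hz⟩
    simp only at hy hg hz
    simp [π, hy.1, hy.2, hg.1, hg.2, hz.1, hz.2, -one_div]
  have hcomp : ∀ R : ℝ × ℝ × ℝ → ℝ, LipschitzOnWith (1 / 2) R K →
      LipschitzWith (1 / 2) (R ∘ π) := by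
    intro R hR
    rw [← lipschitzOnWith_univ] at hπ ⊢
    simpa using hR.comp hπ fun x _ => hπK x
  obtain ⟨g, z, Fh, Qh, hgc, hFhc, hQhc, hz0, hz, hg, hFr, hQr, hFQ⟩ :=
    exists_singular_system (hcomp _ hF2) (hcomp _ hQ2)
  have hFb : ∀ y, |Fh y| ≤ 1 / 2 := by
    intro y
    obtain ⟨x, hx⟩ := hFr y
    rw [← hx]
    exact hF.1 _ (hπK x)
  have hQb : ∀ y, |Qh y - 2 * c| ≤ c / 3 := by
    intro y
    obtain ⟨x, hx⟩ := hQr y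
    rw [← hx]
    exact (hQ.1 _ (hπK x)).trans (min_le_right _ _)
  have hgb : ∀ y ∈ Icc (-1 : ℝ) 1, g y ∈ Icc (c / 3) c := by
    intro y hy
    have := abs_regularSolution_sub_le (r := fun _ => 2 * c) hQhc continuous_const hy.2
      fun w _ => hQb w
    rw [regularSolution_const, ← hg, abs_le] at this
    constructor <;> linarith [this.1, this.2]
  have hzb : ∀ y ∈ Icc (-1 : ℝ) 1, |z y| ≤ 1 / 2 := by
    intro y hy
    have := convex_univ.norm_image_sub_le_of_norm_hasDerivWithin_le
      (fun x _ => (hz x).hasDerivWithinAt) (fun x _ => hFb x) (mem_univ (0 : ℝ)) (mem_univ y)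
    rw [hz0, sub_zero, sub_zero] at this
    have hy' : ‖y‖ ≤ 1 := abs_le.mpr hy
    rw [Real.norm_eq_abs] at this
    linarith
  have hmem : ∀ y ∈ Icc (-1 : ℝ) 1, (y, g y, z y) ∈ K := fun y hy =>
    ⟨hy, hgb y hy, by have := abs_le.mp (hzb y hy); constructor <;> linarith [this.1, this.2]⟩
  have hFh : ∀ y ∈ Icc (-1 : ℝ) 1, Fh y = F (ε, y, g y, z y) := fun y hy => by
    rw [(hFQ y hy).1, Function.comp_apply, hπ1 _ (hmem y hy)]
  have hQh : ∀ y ∈ Icc (-1 : ℝ) 1, Qh y = Q (ε, y, g y, z y) := fun y hy => by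
    rw [(hFQ y hy).2, Function.comp_apply, hπ1 _ (hmem y hy)]
  have hscale : ∀ t ∈ Icc (-ε) ε, t / ε ∈ Icc (-1 : ℝ) 1 := fun t ht =>
    ⟨by rw [le_div_iff₀ hε]; linarith [ht.1], by rw [div_le_one hε]; exact ht.2⟩
  have hH' : ∀ y ∈ Icc (-1 : ℝ) 1, 0 < H (ε, y, g y, z y) := fun y hy => by
    have h : |H (ε, y, g y, z y) - d| ≤ d / 2 := hH _ (hmem y hy)
    linarith [(abs_le.mp h).1]
  have hN' : ∀ y ∈ Icc (-1 : ℝ) 1, 0 < N (ε, y, g y, z y) := fun y hy => by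
    have h : |N (ε, y, g y, z y) - d| ≤ d / 2 := hN _ (hmem y hy)
    linarith [(abs_le.mp h).1]
  have hq : ∀ t, HasDerivAt (fun t => u₀ + ε * z (t / ε)) (Fh (t / ε)) t := by
    intro t
    have := (((hz (t / ε)).comp t ((hasDerivAt_id t).div_const ε)).const_mul ε).const_add u₀
    refine this.congr_deriv ?_
    field_simp
  refine ⟨fun t => u₀ + ε * z (t / ε), fun t => Fh (t / ε),
    fun t => (ε - t) * g (t / ε) + deriv φ (u₀ + ε * z (t / ε) + 2 * t), fun t => g (t / ε),
    by fun_prop, fun t => hFb _, hq, by simp [hz0], ?_, ?_, ?_, fun t => rfl, ?_, ?_, ?_⟩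
  · intro t ht
    have := hzb _ (hscale t ht)
    rw [add_sub_cancel_left, abs_mul, abs_of_pos hε]
    nlinarith
  · have : Continuous z := continuous_iff_continuousAt.mpr fun y => (hz y).continuousAt
    have := hφ1.continuous
    fun_prop
  · intro t ht
    have hy := hscale t ⟨ht.1, ht.2.le⟩
    have hne : t / ε ≠ 1 := ((div_lt_one hε).mpr ht.2).ne
    have hg1 : HasDerivAt g ((3 * g (t / ε) - Qh (t / ε)) / (1 - t / ε)) (t / ε) := by
      have := hasDerivAt_regularSolution hQhc hne
      rw [← hg] at this
      exact this.congr_of_eventuallyEq (Eventually.of_forall hg)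
    have hg2 := hg1.comp t ((hasDerivAt_id t).div_const ε)
    have hp := (hq t).add ((hasDerivAt_id t).const_mul 2)
    have hφd : HasDerivAt (deriv φ) (deriv (deriv φ) (u₀ + ε * z (t / ε) + 2 * t))
        (u₀ + ε * z (t / ε) + 2 * t) :=
      (hφ1.differentiable (by simp)).differentiableAt.hasDerivAt
    have h3 := (((hasDerivAt_id t).const_sub ε).mul hg2).add (hφd.comp t hp)
    refine h3.congr_deriv ?_
    have ht' : ε - t ≠ 0 := (sub_pos.mpr ht.2).ne'
    have e1 : (1 : ℝ) - t / ε = (ε - t) / ε := by field_simp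
    have e2 : 2 * (ε * (t / ε)) = 2 * t := by field_simp
    have e3 : Qh (t / ε) = 2 * deriv (deriv φ) (u₀ + ε * z (t / ε) + 2 * t) - Fh (t / ε) *
        (g (t / ε) - deriv (deriv φ) (u₀ + ε * z (t / ε) + 2 * t)) := by
      rw [hQh _ hy, hFh _ hy]
      simp only [Q, P, e2]
    rw [e1, e3]
    simp only [Function.comp_apply, id]
    field_simp
    ring
  · intro t ht
    have := (hgb _ (hscale t ht)).1
    have : 0 < c / 3 := by positivity
    linarith
  · intro t ht
    have h := hH' _ (hscale t ht)
    have e2 : 2 * (ε * (t / ε)) = 2 * t := by field_simp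
    have e3 : ε * (1 - t / ε) = ε - t := by field_simp
    simp only [H, e2, e3] at h
    linarith
  · intro t ht
    have h := hN' _ (hscale t ht)
    rw [hFh _ (hscale t ht)]
    have e2 : 2 * (ε * (t / ε)) = 2 * t := by field_simp
    have e3 : ε * (1 - t / ε) = ε - t := by field_simp
    have e4 : ε * (1 + t / ε) = ε + t := by field_simp
    simp only [F]
    simp only [N, H, e2, e3, e4] at h ⊢
    have halg : ∀ D x : ℝ, D - x ≠ 0 → 2 * x / (D - x) * D = (2 + 2 * x / (D - x)) * x := by
      intro D x hx
      field_simp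
      ring
    exact halg _ _ h.ne'

/-- A continuous function that is strictly monotone on `[a, b]` has a continuous left inverse
with values in `[a, b]`. -/
lemma exists_continuous_leftInverse {F : ℝ → ℝ} {a b : ℝ} (hab : a ≤ b) (hF : Continuous F)
    (hm : StrictMonoOn F (Icc a b)) :
    ∃ σ : ℝ → ℝ, Continuous σ ∧ (∀ t ∈ Icc a b, σ (F t) = t) ∧ ∀ v ≤ F a, σ v = a := by
  let π : ℝ → ℝ := fun t => max a (min b t)
  have hπ : Continuous π := by fun_prop
  have hπm : ∀ t, π t ∈ Icc a b := fun t => ⟨le_max_left _ _, max_le hab (min_le_left _ _)⟩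
  have hπid : ∀ t ∈ Icc a b, π t = t := fun t ht => by simp [π, ht.1, ht.2]
  have hπmono : Monotone π := fun s t h => max_le_max le_rfl (min_le_min le_rfl h)
  have hπdiff : ∀ s t, s ≤ t → π t - π s ≤ t - s := by
    intro s t h
    simp only [π]
    rcases le_total b s with h1 | h1 <;> rcases le_total b t with h2 | h2 <;>
    rcases le_total a s with h3 | h3 <;> rcases le_total a t with h4 | h4 <;>
    simp [h1, h2, h3, h4, hab] <;> linarith
  -- Continuing `F` with slope 1 outside `[a, b]` gives an increasing bijection of the line.
  let E : ℝ → ℝ := fun t => F (π t) + (t - π t)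
  have hE : Continuous E := by fun_prop
  have hEm : StrictMono E := by
    intro s t h
    have h1 := hm.monotoneOn (hπm s) (hπm t) (hπmono h.le)
    have h2 := hπdiff s t h.le
    rcases (hπmono h.le).lt_or_eq with h3 | h3
    · have := hm (hπm s) (hπm t) h3
      simp only [E]; linarith
    · simp only [E, h3]; linarith
  have hEs : Function.Surjective E := by
    refine hE.surjective ?_ ?_
    · refine tendsto_atTop_mono (f := fun t => t + (F a - b)) (fun t => ?_)
        (tendsto_atTop_add_const_right _ _ tendsto_id)
      have := hm.monotoneOn (left_mem_Icc.mpr hab) (hπm t) (hπm t).1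
      have := (hπm t).2
      simp only [E]; linarith
    · refine tendsto_atBot_mono (f := fun t => t + (F b - a)) (fun t => ?_)
        (tendsto_atBot_add_const_right _ _ tendsto_id)
      have := hm.monotoneOn (hπm t) (right_mem_Icc.mpr hab) (hπm t).2
      have := (hπm t).1
      simp only [E]; linarith
  let e := hEm.orderIsoOfSurjective E hEs
  have hleft : ∀ t, e.symm (E t) = t := fun t => e.symm_apply_apply t
  have hEF : ∀ t ∈ Icc a b, E t = F t := fun t ht => by simp [E, hπid t ht]
  refine ⟨fun v => π (e.symm v), hπ.comp e.symm.continuous, fun t ht => ?_, fun v hv => ?_⟩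
  · simp only [← hEF t ht, hleft, hπid t ht]
  · have ha := left_mem_Icc.mpr hab
    have h1 : e.symm v ≤ a := by
      rw [← hleft a, hEF a ha]
      exact e.symm.monotone hv
    have h2 := hπmono h1
    rw [hπid a ha] at h2
    exact le_antisymm h2 (hπm _).1

/-! ### Monotonicity, a conserved quantity and the slopes along the flow -/

namespace IsSpineFlow

variable {ε : ℝ} {φ ψ : ℝ → ℝ} {u₀ : ℝ} {q r m g : ℝ → ℝ}

lemma one_add_r_pos (h : IsSpineFlow ε φ ψ u₀ q r m g) (t : ℝ) : 0 < 1 + r t := by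
  have := (abs_le.mp (h.abs_r_le t)).1
  linarith

lemma two_add_r_pos (h : IsSpineFlow ε φ ψ u₀ q r m g) (t : ℝ) : 0 < 2 + r t := by
  have := h.one_add_r_pos t
  linarith

lemma r_pos (h : IsSpineFlow ε φ ψ u₀ q r m g) {t : ℝ} (ht : t ∈ Ioc (-ε) ε) : 0 < r t := by
  have ht' : t ∈ Icc (-ε) ε := ⟨ht.1.le, ht.2⟩
  have h1 : 0 < (2 + r t) * ((ε + t) * g t) :=
    mul_pos (h.two_add_r_pos t) (mul_pos (by linarith [ht.1]) (h.g_pos t ht'))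
  rw [← h.r_mul t ht'] at h1
  exact pos_of_mul_pos_left h1 (sub_pos.mpr (h.lt_m t ht')).le

/-- The factor `ε + t` vanishes at the lower end while `D₋` does not. There the spine has slope 1.
-/
lemma r_left (h : IsSpineFlow ε φ ψ u₀ q r m g) (hε : 0 < ε) : r (-ε) = 0 := by
  have ht : -ε ∈ Icc (-ε) ε := ⟨le_rfl, by linarith⟩
  have h1 := h.r_mul _ ht
  have h2 := h.lt_m _ ht
  simp only [add_neg_cancel, zero_mul, mul_zero, mul_eq_zero] at h1
  rcases h1 with h1 | h1
  · exact h1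
  · linarith

lemma r_nonneg (h : IsSpineFlow ε φ ψ u₀ q r m g) (hε : 0 < ε) {t : ℝ} (ht : t ∈ Icc (-ε) ε) :
    0 ≤ r t := by
  rcases ht.1.eq_or_lt with h1 | h1
  · rw [← h1, h.r_left hε]
  · exact (h.r_pos ⟨h1, ht.2⟩).le

lemma continuous_q (h : IsSpineFlow ε φ ψ u₀ q r m g) : Continuous q :=
  continuous_iff_continuousAt.mpr fun t => (h.hasDerivAt_q t).continuousAt

lemma strictMonoOn_q (h : IsSpineFlow ε φ ψ u₀ q r m g) : StrictMonoOn q (Icc (-ε) ε) := by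
  refine strictMonoOn_of_deriv_pos (convex_Icc _ _) h.continuous_q.continuousOn fun t ht => ?_
  rw [interior_Icc] at ht
  rw [(h.hasDerivAt_q t).deriv]
  exact h.r_pos ⟨ht.1, ht.2.le⟩

lemma hasDerivAt_p (h : IsSpineFlow ε φ ψ u₀ q r m g) (t : ℝ) :
    HasDerivAt (fun t => q t + 2 * t) (2 + r t) t :=
  ((h.hasDerivAt_q t).add ((hasDerivAt_id t).const_mul 2)).congr_deriv (by ring)

lemma strictMono_p (h : IsSpineFlow ε φ ψ u₀ q r m g) : StrictMono fun t => q t + 2 * t :=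
  strictMono_of_deriv_pos fun t => by
    rw [(h.hasDerivAt_p t).deriv]; exact h.two_add_r_pos t

/-- The function `m` is the difference quotient of the boundary data at the ends of the ribs. -/
lemma two_mul_m (h : IsSpineFlow ε φ ψ u₀ q r m g) (hε : 0 < ε) (hφ : Differentiable ℝ φ)
    (hψ : Differentiable ℝ ψ) (h0 : φ u₀ = ψ u₀) {t : ℝ} (ht : t ∈ Icc (-ε) ε) :
    2 * t * m t = φ (q t + 2 * t) - ψ (q t) := by
  -- This quantity is conserved and vanishes at `t = 0`, where the rib ends coincide with `u₀`.
  -- Differentiability of `m` at `t = ε` is not available, hence right derivatives on the half-open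
  -- interval and continuity at its end.
  let k : ℝ → ℝ := fun t => 2 * t * m t - (φ (q t + 2 * t) - ψ (q t))
  have hk : ∀ t ∈ Ico (-ε) ε, HasDerivWithinAt k 0 (Ici t) t := by
    intro t ht
    have ht' : t ∈ Icc (-ε) ε := ⟨ht.1, ht.2.le⟩
    have h1 := (((hasDerivAt_id t).const_mul 2).mul (h.hasDerivAt_m t ht)).sub
      (((hφ _).hasDerivAt.comp t (h.hasDerivAt_p t)).sub
        ((hψ _).hasDerivAt.comp t (h.hasDerivAt_q t)))
    refine (h1.congr_deriv ?_).hasDerivWithinAt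
    have h2 := h.r_mul t ht'
    have h3 := h.m_eq t
    simp only [id]
    linear_combination (-1 : ℝ) * h2 + (2 + r t) * h3
  have hc : ContinuousOn k (Icc (-ε) ε) := by
    have := h.continuous_q
    have := h.continuous_m
    have := hφ.continuous
    have := hψ.continuous
    exact Continuous.continuousOn (by fun_prop)
  have hconst := constant_of_has_deriv_right_zero hc hk
  have h1 := hconst t ht
  rw [← hconst 0 ⟨by linarith, hε.le⟩] at h1
  simp only [k, h.q_zero, h0, mul_zero, zero_mul, add_zero, sub_self] at h1
  linarith

/-- The slope of the candidate along the upper ribs and along the segments on the left. -/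
lemma exists_upper_slope {fp fm : ℝ → ℝ} (hfp : ContDiff ℝ 2 fp) (hfm : ContDiff ℝ 2 fm)
    (h : IsSpineFlow ε (deriv fp) (deriv fm) u₀ q r m g) (hε : 0 < ε)
    (h0 : deriv fp u₀ = deriv fm u₀) :
    ∃ M κ : ℝ → ℝ, Continuous M ∧ (∀ p, HasDerivAt κ (-M p) p) ∧
      (∀ p ≤ q (-ε) + 2 * (-ε), M p = (deriv fm (p + 2 * ε) - deriv fp p) / (2 * ε) ∧
        κ p = (fp p - fm (p + 2 * ε)) / (2 * ε)) ∧
      ∀ t ∈ Icc (-ε) ε, M (q t + 2 * t) = m t ∧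
        κ (q t + 2 * t) = (fp (q t + 2 * t) - fm (q t) - (ε + t) *
          (2 * ε * m t + deriv fp (q t + 2 * t) + deriv fm (q t))) / (2 * ε) := by
  have hφ : ContDiff ℝ 1 (deriv fp) := by
    have : ContDiff ℝ (1 + 1) fp := by simpa [one_add_one_eq_two] using hfp
    exact (contDiff_succ_iff_deriv.mp this).2.2
  have hψ : ContDiff ℝ 1 (deriv fm) := by
    have : ContDiff ℝ (1 + 1) fm := by simpa [one_add_one_eq_two] using hfm
    exact (contDiff_succ_iff_deriv.mp this).2.2
  have hφd : Differentiable ℝ (deriv fp) := hφ.differentiable (by simp)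
  have hψd : Differentiable ℝ (deriv fm) := hψ.differentiable (by simp)
  have hfpd : Differentiable ℝ fp := hfp.differentiable (by simp)
  have hfmd : Differentiable ℝ fm := hfm.differentiable (by simp)
  have hqc := h.continuous_q
  have hmc := h.continuous_m
  have hpc : Continuous fun t => q t + 2 * t := by fun_prop
  have ha : -ε ∈ Icc (-ε) ε := ⟨le_rfl, by linarith⟩
  obtain ⟨σ, hσc, hσ, hσl⟩ := exists_continuous_leftInverse (a := -ε) (b := ε) (by linarith) hpc
    (h.strictMono_p.strictMonoOn _)
  set a := q (-ε) + 2 * (-ε) with ha_def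
  have haq : a + 2 * ε = q (-ε) := by rw [ha_def]; ring
  let l : ℝ → ℝ := fun p => (deriv fm (p + 2 * ε) - deriv fp p) / (2 * ε)
  have hlc : Continuous l := by
    have := hφ.continuous
    have := hψ.continuous
    fun_prop
  have hla : l a = m (-ε) := by
    have := h.two_mul_m hε hφd hψd h0 ha
    simp only [l, haq]
    rw [div_eq_iff (by positivity)]
    linarith
  -- `σ` recovers the height from the upper rib end and is constant to the left of `a`; the second
  -- term is zero to the right of `a`. Thus `m` and the difference quotient `l` are joined
  -- continuously at `a`.
  let M : ℝ → ℝ := fun p => m (σ p) + (l (min p a) - l a)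
  have hMc : Continuous M := by fun_prop
  let κ : ℝ → ℝ := fun p => (fp a - fm (a + 2 * ε)) / (2 * ε) - ∫ x in a..p, M x
  have hκ : ∀ p, HasDerivAt κ (-M p) p := fun p =>
    ((hMc.integral_hasStrictDerivAt a p).hasDerivAt.const_sub _)
  have hκa : κ a = (fp a - fm (a + 2 * ε)) / (2 * ε) := by simp [κ]
  have hMl : ∀ p ≤ a, M p = l p := fun p hp => by
    simp only [M, hσl p hp, min_eq_left hp, hla]; ring
  have hMs : ∀ t ∈ Icc (-ε) ε, M (q t + 2 * t) = m t := fun t ht => by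
    have : a ≤ q t + 2 * t := h.strictMono_p.monotone ht.1
    simp only [M, hσ t ht, min_eq_right this]; ring
  refine ⟨M, κ, hMc, hκ, fun p hp => ⟨hMl p hp, ?_⟩, fun t ht => ⟨hMs t ht, ?_⟩⟩
  · let k : ℝ → ℝ := fun p => κ p - (fp p - fm (p + 2 * ε)) / (2 * ε)
    have hk : ∀ x, HasDerivAt k (-M x - (deriv fp x - deriv fm (x + 2 * ε)) / (2 * ε)) x := by
      intro x
      have h1 : HasDerivAt (fun x => fm (x + 2 * ε)) (deriv fm (x + 2 * ε)) x :=
        (hfmd _).hasDerivAt.comp_add_const x (2 * ε)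
      exact (hκ x).sub (((hfpd x).hasDerivAt.sub h1).div_const _)
    have hconst := constant_of_has_deriv_right_zero (f := k) (a := p) (b := a)
      (fun x _ => (hk x).continuousAt.continuousWithinAt) (fun x hx => by
        refine ((hk x).congr_deriv ?_).hasDerivWithinAt
        rw [hMl x hx.2.le]
        simp only [l]
        ring)
    have := hconst a (right_mem_Icc.mpr hp)
    simp only [k, hκa] at this
    linarith
  -- At `t = -ε` the factor `ε + t` kills the last term, and `k = 0` is the normalization of `κ` at
  -- `a`.
  · let k : ℝ → ℝ := fun t => κ (q t + 2 * t) - (fp (q t + 2 * t) - fm (q t) - (ε + t) *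
          (2 * ε * m t + deriv fp (q t + 2 * t) + deriv fm (q t))) / (2 * ε)
    have hk : ∀ t ∈ Ico (-ε) ε, HasDerivWithinAt k 0 (Ici t) t := by
      intro t ht
      have ht' : t ∈ Icc (-ε) ε := ⟨ht.1, ht.2.le⟩
      have d1 := (hκ _).comp t (h.hasDerivAt_p t)
      have d2 := (hfpd _).hasDerivAt.comp t (h.hasDerivAt_p t)
      have d3 := (hfmd _).hasDerivAt.comp t (h.hasDerivAt_q t)
      have d4 := (hφd _).hasDerivAt.comp t (h.hasDerivAt_p t)
      have d5 := (hψd _).hasDerivAt.comp t (h.hasDerivAt_q t)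
      have d6 := d1.sub (((d2.sub d3).sub (((hasDerivAt_id t).const_add ε).mul
        ((((h.hasDerivAt_m t ht).const_mul (2 * ε)).add d4).add d5))).div_const (2 * ε))
      refine (d6.congr_deriv ?_).hasDerivWithinAt
      have h1 := h.r_mul t ht'
      have h2 := h.m_eq t
      have h3 := h.two_mul_m hε hφd hψd h0 ht'
      simp only [id, hMs t ht']
      field_simp
      simp only [Pi.add_apply, Function.comp_apply]
      linear_combination -(ε + t) * h1 - (ε + t) * (2 + r t) * h2 + (1 + r t) * h3
    have hc : ContinuousOn k (Icc (-ε) ε) := by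
      have hκc : Continuous κ := continuous_iff_continuousAt.mpr fun p => (hκ p).continuousAt
      have := hφ.continuous
      have := hψ.continuous
      have := hfp.continuous
      have := hfm.continuous
      exact Continuous.continuousOn (by fun_prop)
    have := constant_of_has_deriv_right_zero hc hk t ht
    simp only [k, ← ha_def, hκa, haq] at this
    linear_combination this

/-- The slope of the candidate along the lower ribs and along the segments on the right. -/
lemma exists_lower_slope {fp fm : ℝ → ℝ} (hfp : ContDiff ℝ 2 fp) (hfm : ContDiff ℝ 2 fm)
    (h : IsSpineFlow ε (deriv fp) (deriv fm) u₀ q r m g) (hε : 0 < ε)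
    (h0 : deriv fp u₀ = deriv fm u₀) :
    ∃ M κ : ℝ → ℝ, Continuous M ∧ (∀ p, HasDerivAt κ (M p) p) ∧
      (∀ p, q ε ≤ p → M p = (deriv fp (p + 2 * ε) - deriv fm p) / (2 * ε) ∧
        κ p = (fp (p + 2 * ε) - fm p) / (2 * ε)) ∧
      ∀ t ∈ Icc (-ε) ε, M (q t) = m t ∧
        κ (q t) = (fp (q t + 2 * t) - fm (q t) + (ε - t) *
          (2 * ε * m t + deriv fp (q t + 2 * t) + deriv fm (q t))) / (2 * ε) := by
  have hφ : ContDiff ℝ 1 (deriv fp) := by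
    have : ContDiff ℝ (1 + 1) fp := by simpa [one_add_one_eq_two] using hfp
    exact (contDiff_succ_iff_deriv.mp this).2.2
  have hψ : ContDiff ℝ 1 (deriv fm) := by
    have : ContDiff ℝ (1 + 1) fm := by simpa [one_add_one_eq_two] using hfm
    exact (contDiff_succ_iff_deriv.mp this).2.2
  have hφd : Differentiable ℝ (deriv fp) := hφ.differentiable (by simp)
  have hψd : Differentiable ℝ (deriv fm) := hψ.differentiable (by simp)
  have hfpd : Differentiable ℝ fp := hfp.differentiable (by simp)
  have hfmd : Differentiable ℝ fm := hfm.differentiable (by simp)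
  have hqc := h.continuous_q
  have hmc := h.continuous_m
  have hb : ε ∈ Icc (-ε) ε := ⟨by linarith, le_rfl⟩
  obtain ⟨σ, hσc, hσ, -⟩ := exists_continuous_leftInverse (a := -ε) (b := ε) (by linarith) hqc
    h.strictMonoOn_q
  set b := q ε with hb_def
  let l : ℝ → ℝ := fun p => (deriv fp (p + 2 * ε) - deriv fm p) / (2 * ε)
  have hlc : Continuous l := by
    have := hφ.continuous
    have := hψ.continuous
    fun_prop
  have hlb : l b = m ε := by
    have := h.two_mul_m hε hφd hψd h0 hb
    simp only [l, hb_def]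
    rw [div_eq_iff (by positivity)]
    linarith
  let M : ℝ → ℝ := fun p => m (σ (min p b)) + (l (max p b) - l b)
  have hMc : Continuous M := by fun_prop
  let κ : ℝ → ℝ := fun p => (fp (b + 2 * ε) - fm b) / (2 * ε) + ∫ x in b..p, M x
  have hκ : ∀ p, HasDerivAt κ (M p) p := fun p =>
    ((hMc.integral_hasStrictDerivAt b p).hasDerivAt.const_add _)
  have hκb : κ b = (fp (b + 2 * ε) - fm b) / (2 * ε) := by simp [κ]
  have hMl : ∀ p, b ≤ p → M p = l p := fun p hp => by
    have hσb : σ b = ε := hσ ε hb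
    simp only [M, min_eq_right hp, max_eq_left hp, hσb, hlb]; ring
  have hMs : ∀ t ∈ Icc (-ε) ε, M (q t) = m t := fun t ht => by
    have : q t ≤ b := h.strictMonoOn_q.monotoneOn ht hb ht.2
    simp only [M, min_eq_left this, hσ t ht, max_eq_right this]; ring
  refine ⟨M, κ, hMc, hκ, fun p hp => ⟨hMl p hp, ?_⟩, fun t ht => ⟨hMs t ht, ?_⟩⟩
  · let k : ℝ → ℝ := fun p => κ p - (fp (p + 2 * ε) - fm p) / (2 * ε)
    have hk : ∀ x, HasDerivAt k (M x - (deriv fp (x + 2 * ε) - deriv fm x) / (2 * ε)) x := by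
      intro x
      have h1 : HasDerivAt (fun x => fp (x + 2 * ε)) (deriv fp (x + 2 * ε)) x :=
        (hfpd _).hasDerivAt.comp_add_const x (2 * ε)
      exact (hκ x).sub ((h1.sub (hfmd x).hasDerivAt).div_const _)
    have hconst := constant_of_has_deriv_right_zero (f := k) (a := b) (b := p)
      (fun x _ => (hk x).continuousAt.continuousWithinAt) (fun x hx => by
        refine ((hk x).congr_deriv ?_).hasDerivWithinAt
        rw [hMl x hx.1]
        simp only [l]
        ring)
    have := hconst p (right_mem_Icc.mpr hp)
    simp only [k, hκb] at this
    linarith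
  · let k : ℝ → ℝ := fun t => κ (q t) - (fp (q t + 2 * t) - fm (q t) + (ε - t) *
          (2 * ε * m t + deriv fp (q t + 2 * t) + deriv fm (q t))) / (2 * ε)
    have hk : ∀ t ∈ Ico (-ε) ε, HasDerivWithinAt k 0 (Ici t) t := by
      intro t ht
      have ht' : t ∈ Icc (-ε) ε := ⟨ht.1, ht.2.le⟩
      have d1 := (hκ _).comp t (h.hasDerivAt_q t)
      have d2 := (hfpd _).hasDerivAt.comp t (h.hasDerivAt_p t)
      have d3 := (hfmd _).hasDerivAt.comp t (h.hasDerivAt_q t)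
      have d4 := (hφd _).hasDerivAt.comp t (h.hasDerivAt_p t)
      have d5 := (hψd _).hasDerivAt.comp t (h.hasDerivAt_q t)
      have d6 := d1.sub (((d2.sub d3).add (((hasDerivAt_id t).const_sub ε).mul
        ((((h.hasDerivAt_m t ht).const_mul (2 * ε)).add d4).add d5))).div_const (2 * ε))
      refine (d6.congr_deriv ?_).hasDerivWithinAt
      have h1 := h.r_mul t ht'
      have h2 := h.m_eq t
      have h3 := h.two_mul_m hε hφd hψd h0 ht'
      simp only [id, hMs t ht']
      field_simp
      simp only [Pi.add_apply, Function.comp_apply]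
      linear_combination (ε - t) * h1 + (ε - t) * (2 + r t) * h2 + (1 + r t) * h3
    have hc : ContinuousOn k (Icc (-ε) ε) := by
      have hκc : Continuous κ := continuous_iff_continuousAt.mpr fun p => (hκ p).continuousAt
      have := hφ.continuous
      have := hψ.continuous
      have := hfp.continuous
      have := hfm.continuous
      exact Continuous.continuousOn (by fun_prop)
    -- The normalization now sits at `t = ε`, where the factor `ε - t` vanishes, so the constant is
    -- evaluated at that end.
    have hconst := constant_of_has_deriv_right_zero hc hk
    have := (hconst t ht).trans (hconst ε hb).symm
    simp only [k, ← hb_def, hκb] at this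
    linear_combination this

end IsSpineFlow

/-! ### The glued candidate -/

/-- A function with boundary values `f` on the upper line and slope `κ` along the left segments. -/
noncomputable def upperPart (ε : ℝ) (f κ : ℝ → ℝ) (x : ℝ × ℝ) : ℝ :=
  f (x.1 + x.2 - ε) - (ε - x.2) * κ (x.1 + x.2 - ε)

/-- A function with boundary values `f` on the lower line and slope `κ` along the right
segments. -/
noncomputable def lowerPart (ε : ℝ) (f κ : ℝ → ℝ) (x : ℝ × ℝ) : ℝ :=
  f (x.1 - x.2 - ε) + (ε + x.2) * κ (x.1 - x.2 - ε)

/-- The differential of `upperPart` when `κ' = -M`. -/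
noncomputable def upperDeriv (ε : ℝ) (f M κ : ℝ → ℝ) (x : ℝ × ℝ) : ℝ × ℝ →L[ℝ] ℝ :=
  (deriv f (x.1 + x.2 - ε) + (ε - x.2) * M (x.1 + x.2 - ε)) •
    (ContinuousLinearMap.fst ℝ ℝ ℝ + ContinuousLinearMap.snd ℝ ℝ ℝ) +
    κ (x.1 + x.2 - ε) • ContinuousLinearMap.snd ℝ ℝ ℝ

/-- The differential of `lowerPart` when `κ' = M`. -/
noncomputable def lowerDeriv (ε : ℝ) (f M κ : ℝ → ℝ) (x : ℝ × ℝ) : ℝ × ℝ →L[ℝ] ℝ :=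
  (deriv f (x.1 - x.2 - ε) + (ε + x.2) * M (x.1 - x.2 - ε)) •
    (ContinuousLinearMap.fst ℝ ℝ ℝ - ContinuousLinearMap.snd ℝ ℝ ℝ) +
    κ (x.1 - x.2 - ε) • ContinuousLinearMap.snd ℝ ℝ ℝ

lemma hasFDerivAt_upperPart {ε : ℝ} {f M κ : ℝ → ℝ} (hf : Differentiable ℝ f)
    (hκ : ∀ p, HasDerivAt κ (-M p) p) (x : ℝ × ℝ) :
    HasFDerivAt (upperPart ε f κ) (upperDeriv ε f M κ x) x := by
  have h1 : HasFDerivAt (fun x : ℝ × ℝ => x.1 + x.2 - ε)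
      (ContinuousLinearMap.fst ℝ ℝ ℝ + ContinuousLinearMap.snd ℝ ℝ ℝ) x :=
    (hasFDerivAt_fst.add hasFDerivAt_snd).sub_const ε
  have h2 : HasFDerivAt (fun x : ℝ × ℝ => ε - x.2) (-ContinuousLinearMap.snd ℝ ℝ ℝ) x :=
    hasFDerivAt_snd.const_sub ε
  have h3 := ((hf _).hasDerivAt.comp_hasFDerivAt x h1).sub
    (h2.mul ((hκ _).comp_hasFDerivAt x h1))
  refine h3.congr_fderiv ?_
  ext
  · simp [upperDeriv]
  · simp [upperDeriv]
    ring

lemma hasFDerivAt_lowerPart {ε : ℝ} {f M κ : ℝ → ℝ} (hf : Differentiable ℝ f)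
    (hκ : ∀ p, HasDerivAt κ (M p) p) (x : ℝ × ℝ) :
    HasFDerivAt (lowerPart ε f κ) (lowerDeriv ε f M κ x) x := by
  have h1 : HasFDerivAt (fun x : ℝ × ℝ => x.1 - x.2 - ε)
      (ContinuousLinearMap.fst ℝ ℝ ℝ - ContinuousLinearMap.snd ℝ ℝ ℝ) x :=
    (hasFDerivAt_fst.sub hasFDerivAt_snd).sub_const ε
  have h2 : HasFDerivAt (fun x : ℝ × ℝ => ε + x.2) (ContinuousLinearMap.snd ℝ ℝ ℝ) x :=
    hasFDerivAt_snd.const_add ε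
  have h3 := ((hf _).hasDerivAt.comp_hasFDerivAt x h1).add
    (h2.mul ((hκ _).comp_hasFDerivAt x h1))
  refine h3.congr_fderiv ?_
  ext
  · simp [lowerDeriv]
  · simp [lowerDeriv]
    ring

lemma continuous_upperDeriv {ε : ℝ} {f M κ : ℝ → ℝ} (hf : Continuous (deriv f))
    (hM : Continuous M) (hκ : Continuous κ) : Continuous (upperDeriv ε f M κ) := by
  unfold upperDeriv
  fun_prop

lemma continuous_lowerDeriv {ε : ℝ} {f M κ : ℝ → ℝ} (hf : Continuous (deriv f))
    (hM : Continuous M) (hκ : Continuous κ) : Continuous (lowerDeriv ε f M κ) := by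
  unfold lowerDeriv
  fun_prop

/-- Functions that agree together with their differentials on the common part of two closed sets
glue to a differentiable function. -/
lemma hasFDerivWithinAt_glue {E F : Type*} [NormedAddCommGroup E] [NormedSpace ℝ E]
    [NormedAddCommGroup F] [NormedSpace ℝ F] {s t : Set E} {f f₁ f₂ : E → F}
    {f' f₁' f₂' : E → E →L[ℝ] F} (hs : IsClosed s) (ht : IsClosed t)
    (h1 : ∀ x, HasFDerivAt f₁ (f₁' x) x) (h2 : ∀ x, HasFDerivAt f₂ (f₂' x) x)
    (e1 : EqOn f f₁ s) (e2 : EqOn f f₂ t) (d1 : EqOn f' f₁' s) (d2 : EqOn f' f₂' t) (x : E) :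
    HasFDerivWithinAt f (f' x) (s ∪ t) x := by
  have key : ∀ (s : Set E) (g : E → F) (g' : E → E →L[ℝ] F), IsClosed s →
      (∀ x, HasFDerivAt g (g' x) x) → EqOn f g s → EqOn f' g' s →
      HasFDerivWithinAt f (f' x) s x := by
    intro s g g' hs hg e d
    by_cases hx : x ∈ s
    · rw [d hx]
      exact (hg x).hasFDerivWithinAt.congr e (e hx)
    · exact HasFDerivWithinAt.of_notMem_closure (by rwa [hs.closure_eq])
  exact (key s f₁ f₁' hs h1 e1 d1).union (key t f₂ f₂' ht h2 e2 d2)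

/-- The data of the glued candidate: the flow of the spine and the slopes `κu`, `κl` of the
candidate along the left and the right segments. -/
structure IsFissureData (ε : ℝ) (fp fm : ℝ → ℝ) (u₀ : ℝ) (q r m g Mu κu Ml κl : ℝ → ℝ) :
    Prop where
  pos : 0 < ε
  contDiff_fp : ContDiff ℝ (⊤ : ℕ∞) fp
  contDiff_fm : ContDiff ℝ (⊤ : ℕ∞) fm
  flow : IsSpineFlow ε (deriv fp) (deriv fm) u₀ q r m g
  two_mul_m : ∀ t ∈ Icc (-ε) ε, 2 * t * m t = deriv fp (q t + 2 * t) - deriv fm (q t)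
  continuous_Mu : Continuous Mu
  hasDerivAt_κu : ∀ p, HasDerivAt κu (-Mu p) p
  upper_left : ∀ p ≤ q (-ε) + 2 * (-ε),
    Mu p = (deriv fm (p + 2 * ε) - deriv fp p) / (2 * ε) ∧
      κu p = (fp p - fm (p + 2 * ε)) / (2 * ε)
  upper_spine : ∀ t ∈ Icc (-ε) ε, Mu (q t + 2 * t) = m t ∧
    κu (q t + 2 * t) = (fp (q t + 2 * t) - fm (q t) - (ε + t) *
      (2 * ε * m t + deriv fp (q t + 2 * t) + deriv fm (q t))) / (2 * ε)
  continuous_Ml : Continuous Ml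
  hasDerivAt_κl : ∀ p, HasDerivAt κl (Ml p) p
  lower_right : ∀ p, q ε ≤ p →
    Ml p = (deriv fp (p + 2 * ε) - deriv fm p) / (2 * ε) ∧
      κl p = (fp (p + 2 * ε) - fm p) / (2 * ε)
  lower_spine : ∀ t ∈ Icc (-ε) ε, Ml (q t) = m t ∧
    κl (q t) = (fp (q t + 2 * t) - fm (q t) + (ε - t) *
      (2 * ε * m t + deriv fp (q t + 2 * t) + deriv fm (q t))) / (2 * ε)

/-- The glued candidate: the spine is the graph `x₁ = q x₂ + x₂ + ε`. -/
noncomputable def glued (ε : ℝ) (fp fm q κu κl : ℝ → ℝ) (x : ℝ × ℝ) : ℝ :=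
  if x.1 ≤ q x.2 + x.2 + ε then upperPart ε fp κu x else lowerPart ε fm κl x

/-- The differential of the glued candidate. -/
noncomputable def gluedDeriv (ε : ℝ) (fp fm q Mu κu Ml κl : ℝ → ℝ) (x : ℝ × ℝ) :
    ℝ × ℝ →L[ℝ] ℝ :=
  if x.1 ≤ q x.2 + x.2 + ε then upperDeriv ε fp Mu κu x else lowerDeriv ε fm Ml κl x

namespace IsFissureData

variable {ε : ℝ} {fp fm : ℝ → ℝ} {u₀ : ℝ} {q r m g Mu κu Ml κl : ℝ → ℝ}

lemma differentiable_fp (h : IsFissureData ε fp fm u₀ q r m g Mu κu Ml κl) :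
    Differentiable ℝ fp := h.contDiff_fp.differentiable (by simp)

lemma differentiable_fm (h : IsFissureData ε fp fm u₀ q r m g Mu κu Ml κl) :
    Differentiable ℝ fm := h.contDiff_fm.differentiable (by simp)

lemma contDiff_deriv_fp (h : IsFissureData ε fp fm u₀ q r m g Mu κu Ml κl) :
    ContDiff ℝ (⊤ : ℕ∞) (deriv fp) := by
  simpa using h.contDiff_fp.iterate_deriv 1

lemma contDiff_deriv_fm (h : IsFissureData ε fp fm u₀ q r m g Mu κu Ml κl) :
    ContDiff ℝ (⊤ : ℕ∞) (deriv fm) := by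
  simpa using h.contDiff_fm.iterate_deriv 1

lemma hasDerivAt_deriv_fp (h : IsFissureData ε fp fm u₀ q r m g Mu κu Ml κl) (p : ℝ) :
    HasDerivAt (deriv fp) (deriv (deriv fp) p) p :=
  (h.contDiff_deriv_fp.differentiable (by simp) p).hasDerivAt

lemma hasDerivAt_deriv_fm (h : IsFissureData ε fp fm u₀ q r m g Mu κu Ml κl) (p : ℝ) :
    HasDerivAt (deriv fm) (deriv (deriv fm) p) p :=
  (h.contDiff_deriv_fm.differentiable (by simp) p).hasDerivAt

lemma continuous_κu (h : IsFissureData ε fp fm u₀ q r m g Mu κu Ml κl) : Continuous κu :=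
  continuous_iff_continuousAt.mpr fun p => (h.hasDerivAt_κu p).continuousAt

lemma continuous_κl (h : IsFissureData ε fp fm u₀ q r m g Mu κu Ml κl) : Continuous κl :=
  continuous_iff_continuousAt.mpr fun p => (h.hasDerivAt_κl p).continuousAt

lemma isClosed_strip (ε : ℝ) : IsClosed (strip ε) :=
  isClosed_le (by fun_prop) continuous_const

lemma lowerPart_eq_upperPart (h : IsFissureData ε fp fm u₀ q r m g Mu κu Ml κl) {x : ℝ × ℝ}
    (hx : x ∈ strip ε) (hs : x.1 = q x.2 + x.2 + ε) :
    upperPart ε fp κu x = lowerPart ε fm κl x := by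
  have ht : x.2 ∈ Icc (-ε) ε := abs_le.mp hx
  have e1 : x.1 + x.2 - ε = q x.2 + 2 * x.2 := by rw [hs]; ring
  have e2 : x.1 - x.2 - ε = q x.2 := by rw [hs]; ring
  have hε := h.pos
  simp only [upperPart, lowerPart, e1, e2, (h.upper_spine _ ht).2, (h.lower_spine _ ht).2]
  field_simp
  ring

/-- In the first coordinate the match is `2 t m = φ - ψ`; in the second it is `κl - κu = 2 ε m + φ +
ψ`, the difference of the two slope formulas. -/
lemma lowerDeriv_eq_upperDeriv (h : IsFissureData ε fp fm u₀ q r m g Mu κu Ml κl) {x : ℝ × ℝ}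
    (hx : x ∈ strip ε) (hs : x.1 = q x.2 + x.2 + ε) :
    upperDeriv ε fp Mu κu x = lowerDeriv ε fm Ml κl x := by
  have ht : x.2 ∈ Icc (-ε) ε := abs_le.mp hx
  have e1 : x.1 + x.2 - ε = q x.2 + 2 * x.2 := by rw [hs]; ring
  have e2 : x.1 - x.2 - ε = q x.2 := by rw [hs]; ring
  have hε := h.pos
  have h2 := h.two_mul_m _ ht
  simp only [upperDeriv, lowerDeriv, e1, e2, (h.upper_spine _ ht).2, (h.lower_spine _ ht).2,
    (h.upper_spine _ ht).1, (h.lower_spine _ ht).1]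
  ext
  · simp
    linear_combination -h2
  · simp
    field_simp
    ring

lemma glued_eq_upperPart {x : ℝ × ℝ} (hs : x.1 ≤ q x.2 + x.2 + ε) :
    glued ε fp fm q κu κl x = upperPart ε fp κu x := if_pos hs

lemma glued_eq_lowerPart (h : IsFissureData ε fp fm u₀ q r m g Mu κu Ml κl) {x : ℝ × ℝ}
    (hx : x ∈ strip ε) (hs : q x.2 + x.2 + ε ≤ x.1) :
    glued ε fp fm q κu κl x = lowerPart ε fm κl x := by
  rcases hs.eq_or_lt with hs | hs
  · rw [glued, if_pos hs.ge]
    exact h.lowerPart_eq_upperPart hx hs.symm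
  · rw [glued, if_neg (not_le.mpr hs)]

lemma gluedDeriv_eq_upperDeriv {x : ℝ × ℝ} (hs : x.1 ≤ q x.2 + x.2 + ε) :
    gluedDeriv ε fp fm q Mu κu Ml κl x = upperDeriv ε fp Mu κu x := if_pos hs

lemma gluedDeriv_eq_lowerDeriv (h : IsFissureData ε fp fm u₀ q r m g Mu κu Ml κl) {x : ℝ × ℝ}
    (hx : x ∈ strip ε) (hs : q x.2 + x.2 + ε ≤ x.1) :
    gluedDeriv ε fp fm q Mu κu Ml κl x = lowerDeriv ε fm Ml κl x := by
  rcases hs.eq_or_lt with hs | hs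
  · rw [gluedDeriv, if_pos hs.ge]
    exact h.lowerDeriv_eq_upperDeriv hx hs.symm
  · rw [gluedDeriv, if_neg (not_le.mpr hs)]

lemma isClosed_upperSide (h : IsFissureData ε fp fm u₀ q r m g Mu κu Ml κl) :
    IsClosed (strip ε ∩ {x | x.1 ≤ q x.2 + x.2 + ε}) := by
  have := h.flow.continuous_q
  exact (isClosed_strip ε).inter (isClosed_le (by fun_prop) (by fun_prop))

lemma isClosed_lowerSide (h : IsFissureData ε fp fm u₀ q r m g Mu κu Ml κl) :
    IsClosed (strip ε ∩ {x | q x.2 + x.2 + ε ≤ x.1}) := by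
  have := h.flow.continuous_q
  exact (isClosed_strip ε).inter (isClosed_le (by fun_prop) (by fun_prop))

lemma strip_eq (ε : ℝ) (q : ℝ → ℝ) : strip ε =
    (strip ε ∩ {x | x.1 ≤ q x.2 + x.2 + ε}) ∪ (strip ε ∩ {x | q x.2 + x.2 + ε ≤ x.1}) := by
  rw [← inter_union_distrib_left]
  refine (inter_eq_left.mpr fun x _ => ?_).symm
  exact le_total x.1 (q x.2 + x.2 + ε)

lemma hasFDerivWithinAt_glued (h : IsFissureData ε fp fm u₀ q r m g Mu κu Ml κl) (x : ℝ × ℝ) :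
    HasFDerivWithinAt (glued ε fp fm q κu κl) (gluedDeriv ε fp fm q Mu κu Ml κl x)
      (strip ε) x := by
  rw [strip_eq ε q]
  exact hasFDerivWithinAt_glue h.isClosed_upperSide h.isClosed_lowerSide
    (hasFDerivAt_upperPart h.differentiable_fp h.hasDerivAt_κu)
    (hasFDerivAt_lowerPart h.differentiable_fm h.hasDerivAt_κl)
    (fun x hx => glued_eq_upperPart hx.2) (fun x hx => h.glued_eq_lowerPart hx.1 hx.2)
    (fun x hx => gluedDeriv_eq_upperDeriv hx.2)
    (fun x hx => h.gluedDeriv_eq_lowerDeriv hx.1 hx.2) x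

lemma continuousOn_gluedDeriv (h : IsFissureData ε fp fm u₀ q r m g Mu κu Ml κl) :
    ContinuousOn (gluedDeriv ε fp fm q Mu κu Ml κl) (strip ε) := by
  rw [strip_eq ε q]
  refine ContinuousOn.union_of_isClosed ?_ ?_ h.isClosed_upperSide h.isClosed_lowerSide
  · exact (continuous_upperDeriv h.contDiff_deriv_fp.continuous h.continuous_Mu
      h.continuous_κu).continuousOn.congr fun x hx => gluedDeriv_eq_upperDeriv hx.2
  · exact (continuous_lowerDeriv h.contDiff_deriv_fm.continuous h.continuous_Ml
      h.continuous_κl).continuousOn.congr fun x hx => h.gluedDeriv_eq_lowerDeriv hx.1 hx.2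

lemma contDiffOn_glued (h : IsFissureData ε fp fm u₀ q r m g Mu κu Ml κl) :
    ContDiffOn ℝ 1 (glued ε fp fm q κu κl) (strip ε) := by
  have : ContDiffOn ℝ (0 + 1) (glued ε fp fm q κu κl) (strip ε) := by
    rw [contDiffOn_succ_iff_hasFDerivWithinAt (by simp)]
    refine fun x hx => ⟨strip ε, ?_, by simp, gluedDeriv ε fp fm q Mu κu Ml κl,
      fun y _ => h.hasFDerivWithinAt_glued y, ?_⟩
    · rw [insert_eq_of_mem hx]
      exact self_mem_nhdsWithin
    · exact contDiffOn_zero.mpr h.continuousOn_gluedDeriv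
  simpa using this

end IsFissureData

/-! ### Diagonal concavity of the glued candidate -/

lemma concaveOn_segment_of_line {B : ℝ × ℝ → ℝ} {s k : ℝ} {x y : ℝ × ℝ} (hx : x.1 = k + s * x.2)
    (hy : y.1 = k + s * y.2)
    (hB : ConcaveOn ℝ (uIcc x.2 y.2) fun τ => B (k + s * τ, τ)) :
    ConcaveOn ℝ (segment ℝ x y) B := by
  have key : ∀ a ∈ segment ℝ x y, a.2 ∈ uIcc x.2 y.2 ∧ a = (k + s * a.2, a.2) := by
    rintro a ⟨α, β, hα, hβ, hαβ, rfl⟩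
    refine ⟨?_, Prod.ext ?_ rfl⟩
    · rw [← segment_eq_uIcc]
      exact ⟨α, β, hα, hβ, hαβ, rfl⟩
    · simp only [Prod.fst_add, Prod.smul_fst, Prod.snd_add, Prod.smul_snd, smul_eq_mul, hx, hy]
      linear_combination k * hαβ
  refine ⟨convex_segment x y, fun a ha b hb α β hα hβ hαβ => ?_⟩
  have hc := convex_segment x y ha hb hα hβ hαβ
  have h := hB.2 (key a ha).1 (key b hb).1 hα hβ hαβ
  simp only [← (key a ha).2, ← (key b hb).2] at h
  rw [(key _ hc).2]
  exact h

lemma upperDeriv_apply (ε : ℝ) (f M κ : ℝ → ℝ) (x : ℝ × ℝ) (s : ℝ) :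
    upperDeriv ε f M κ x (s, 1) = (deriv f (x.1 + x.2 - ε) + (ε - x.2) * M (x.1 + x.2 - ε)) *
      (s + 1) + κ (x.1 + x.2 - ε) := by
  simp [upperDeriv]
  ring

lemma lowerDeriv_apply (ε : ℝ) (f M κ : ℝ → ℝ) (x : ℝ × ℝ) (s : ℝ) :
    lowerDeriv ε f M κ x (s, 1) = (deriv f (x.1 - x.2 - ε) + (ε + x.2) * M (x.1 - x.2 - ε)) *
      (s - 1) + κ (x.1 - x.2 - ε) := by
  simp [lowerDeriv]

/-- The trapezoid between the segments `x₁ + x₂ = p₋ + ε - δ` and `x₁ - x₂ = q₊ + ε + δ`, where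
`p₋` and `q₊` are the ends of the extreme ribs. -/
def trapezoid (ε : ℝ) (q : ℝ → ℝ) (δ : ℝ) : Set (ℝ × ℝ) :=
  {x ∈ strip ε | q (-ε) + 2 * (-ε) - δ ≤ x.1 + x.2 - ε ∧ x.1 - x.2 - ε ≤ q ε + δ}

/-- Nonnegativity of `D₊` and `D₋` along the simple foliations next to the fissure. -/
structure ExtendsBy (ε : ℝ) (fp fm q : ℝ → ℝ) (δ : ℝ) : Prop where
  left : ∀ p ∈ Icc (q (-ε) + 2 * (-ε) - δ) (q (-ε) + 2 * (-ε)),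
    deriv (deriv fp) p ≤ (deriv fm (p + 2 * ε) - deriv fp p) / (2 * ε) ∧
      deriv (deriv fm) (p + 2 * ε) ≤ (deriv fm (p + 2 * ε) - deriv fp p) / (2 * ε)
  right : ∀ p ∈ Icc (q ε) (q ε + δ),
    deriv (deriv fp) (p + 2 * ε) ≤ (deriv fp (p + 2 * ε) - deriv fm p) / (2 * ε) ∧
      deriv (deriv fm) p ≤ (deriv fp (p + 2 * ε) - deriv fm p) / (2 * ε)

namespace IsFissureData

variable {ε : ℝ} {fp fm : ℝ → ℝ} {u₀ : ℝ} {q r m g Mu κu Ml κl : ℝ → ℝ}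

lemma concaveOn_line (h : IsFissureData ε fp fm u₀ q r m g Mu κu Ml κl) {s k a b : ℝ}
    (hs : Icc a b ⊆ Icc (-ε) ε)
    (ha : AntitoneOn (fun τ => gluedDeriv ε fp fm q Mu κu Ml κl (k + s * τ, τ) (s, 1))
      (Icc a b)) :
    ConcaveOn ℝ (Icc a b) fun τ => glued ε fp fm q κu κl (k + s * τ, τ) := by
  have hline : ∀ τ, HasDerivAt (fun τ : ℝ => (k + s * τ, τ)) (s, 1) τ := fun τ => by
    have h1 : HasDerivAt (fun τ : ℝ => k + s * τ) s τ := by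
      simpa using ((hasDerivAt_id τ).const_mul s).const_add k
    exact h1.prodMk (hasDerivAt_id τ)
  have hd : ∀ τ ∈ interior (Icc a b), HasDerivAt (fun τ => glued ε fp fm q κu κl (k + s * τ, τ))
      (gluedDeriv ε fp fm q Mu κu Ml κl (k + s * τ, τ) (s, 1)) τ := by
    intro τ hτ
    have h1 := interior_mono hs hτ
    rw [interior_Icc] at h1
    -- At interior heights the derivative within the strip is a genuine one; at the ends continuity
    -- is enough.
    have h2 : strip ε ∈ 𝓝 (k + s * τ, τ) := by
      have : {x : ℝ × ℝ | x.2 ∈ Ioo (-ε) ε} ∈ 𝓝 (k + s * τ, τ) :=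
        (isOpen_Ioo.preimage continuous_snd).mem_nhds h1
      filter_upwards [this] with x hx
      exact abs_le.mpr ⟨hx.1.le, hx.2.le⟩
    exact ((h.hasFDerivWithinAt_glued _).hasFDerivAt h2).comp_hasDerivAt
      (f := fun τ : ℝ => (k + s * τ, τ)) τ (hline τ)
  refine AntitoneOn.concaveOn_of_deriv (convex_Icc a b) ?_
    (fun τ hτ => (hd τ hτ).differentiableAt.differentiableWithinAt) ?_
  · refine h.contDiffOn_glued.continuousOn.comp (by fun_prop) fun τ hτ => ?_
    exact abs_le.mpr (hs hτ)
  · exact (ha.mono interior_subset).congr fun τ hτ => ((hd τ hτ).deriv).symm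

/-- The compared quantity is the derivative of the candidate in direction `(-1, 1)` where the line
`x₁ + x₂ = ξ` meets the right diagonal with lower end `q t`. For fixed `ξ` its `t`-derivative is `(2
+ r) g (q + 2 t + ε - ξ)`, whose last factor is nonnegative when the meeting point is not above the
spine. -/
lemma lowerTheta_spine (h : IsFissureData ε fp fm u₀ q r m g Mu κu Ml κl) {ξ t₁ t₂ : ℝ}
    (ht₁ : -ε ≤ t₁) (ht : t₁ ≤ t₂) (ht₂ : t₂ ≤ ε) (hξ : ξ ≤ q t₁ + 2 * t₁ + ε) :
    κl (q t₁) - 2 * deriv fm (q t₁) - (ε + ξ - q t₁) * Ml (q t₁) ≤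
      κl (q t₂) - 2 * deriv fm (q t₂) - (ε + ξ - q t₂) * Ml (q t₂) := by
  have hqc := h.flow.continuous_q
  have hmc := h.flow.continuous_m
  have hκc := h.continuous_κl
  have hψc := h.contDiff_deriv_fm.continuous
  have hmono : MonotoneOn (fun t => κl (q t) - 2 * deriv fm (q t) - (ε + ξ - q t) * m t)
      (Icc t₁ t₂) := by
    refine monotoneOn_of_hasDerivWithinAt_nonneg (f' := fun t =>
      (2 + r t) * g t * (q t + 2 * t + ε - ξ)) (convex_Icc _ _)
      (Continuous.continuousOn (by fun_prop)) (fun t ht => ?_) fun t ht => ?_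
    · rw [interior_Icc] at ht ⊢
      have ht' : t ∈ Ico (-ε) ε := ⟨by linarith [ht.1], by linarith [ht.2]⟩
      have ht'' : t ∈ Icc (-ε) ε := ⟨ht'.1, ht'.2.le⟩
      have d1 := (h.hasDerivAt_κl _).comp t (h.flow.hasDerivAt_q t)
      have d2 := ((h.hasDerivAt_deriv_fm _).comp t (h.flow.hasDerivAt_q t)).const_mul 2
      have d3 := ((h.flow.hasDerivAt_q t).const_sub (ε + ξ)).mul (h.flow.hasDerivAt_m t ht')
      refine (((d1.sub d2).sub d3).congr_deriv ?_).hasDerivWithinAt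
      have h1 := h.flow.r_mul t ht''
      rw [(h.lower_spine t ht'').1]
      linear_combination 2 * h1
    · rw [interior_Icc] at ht
      have ht'' : t ∈ Icc (-ε) ε := ⟨by linarith [ht.1], by linarith [ht.2]⟩
      have h1 := h.flow.strictMono_p.monotone ht.1.le
      exact mul_nonneg (mul_nonneg (h.flow.two_add_r_pos t).le (h.flow.g_pos t ht'').le)
        (by linarith)
  have := hmono (left_mem_Icc.mpr ht) (right_mem_Icc.mpr ht) ht
  rw [(h.lower_spine t₁ ⟨ht₁, ht.trans ht₂⟩).1, (h.lower_spine t₂ ⟨ht₁.trans ht, ht₂⟩).1]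
  exact this

/-- At height `τ` the derivative in `p` is a combination of `D₋` and `D₊` of the right foliation
with the weights `2 (ε - τ)` and `2 (ε + τ)`, divided by `2 ε`. -/
lemma lowerTheta_right (h : IsFissureData ε fp fm u₀ q r m g Mu κu Ml κl) {δ : ℝ}
    (hδ : ExtendsBy ε fp fm q δ) {ξ p₁ p₂ : ℝ} (hp₁ : q ε ≤ p₁) (hp : p₁ ≤ p₂)
    (hp₂ : p₂ ≤ q ε + δ) (h₂ : p₂ ≤ ε + ξ) (h₁ : ξ - p₁ ≤ 3 * ε) :
    κl p₁ - 2 * deriv fm p₁ - (ε + ξ - p₁) * Ml p₁ ≤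
      κl p₂ - 2 * deriv fm p₂ - (ε + ξ - p₂) * Ml p₂ := by
  have hε := h.pos
  have hκc := h.continuous_κl
  have hφc := h.contDiff_deriv_fp.continuous
  have hψc := h.contDiff_deriv_fm.continuous
  have hmono : MonotoneOn (fun p => κl p - 2 * deriv fm p -
      (ε + ξ - p) * ((deriv fp (p + 2 * ε) - deriv fm p) / (2 * ε))) (Icc p₁ p₂) := by
    refine monotoneOn_of_hasDerivWithinAt_nonneg (f' := fun p =>
      2 * ((deriv fp (p + 2 * ε) - deriv fm p) / (2 * ε) - deriv (deriv fm) p) - (ε + ξ - p) *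
        ((deriv (deriv fp) (p + 2 * ε) - deriv (deriv fm) p) / (2 * ε))) (convex_Icc _ _)
      (Continuous.continuousOn (by fun_prop)) (fun p hp => ?_) fun p hp => ?_
    · rw [interior_Icc] at hp
      have d1 : HasDerivAt (fun p => deriv fp (p + 2 * ε)) (deriv (deriv fp) (p + 2 * ε)) p :=
        (h.hasDerivAt_deriv_fp _).comp_add_const p (2 * ε)
      have d2 := h.hasDerivAt_deriv_fm p
      have d3 := ((h.hasDerivAt_κl p).sub (d2.const_mul 2)).sub
        (((hasDerivAt_id p).const_sub (ε + ξ)).mul ((d1.sub d2).div_const (2 * ε)))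
      refine (d3.congr_deriv ?_).hasDerivWithinAt
      rw [(h.lower_right p (hp₁.trans hp.1.le)).1]
      simp only [id, Pi.sub_apply]
      ring
    · rw [interior_Icc] at hp
      have h1 := hδ.right p ⟨by linarith [hp.1], by linarith [hp.2]⟩
      set l := (deriv fp (p + 2 * ε) - deriv fm p) / (2 * ε)
      have e : 2 * (l - deriv (deriv fm) p) - (ε + ξ - p) *
          ((deriv (deriv fp) (p + 2 * ε) - deriv (deriv fm) p) / (2 * ε)) =
          ((3 * ε - ξ + p) * (l - deriv (deriv fm) p) +
            (ε + ξ - p) * (l - deriv (deriv fp) (p + 2 * ε))) / (2 * ε) := by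
        field_simp
        ring
      rw [e]
      refine div_nonneg (add_nonneg (mul_nonneg ?_ ?_) (mul_nonneg ?_ ?_)) (by positivity) <;>
        linarith [hp.1, hp.2, h1.1, h1.2]
  have := hmono (left_mem_Icc.mpr hp) (right_mem_Icc.mpr hp) hp
  rw [(h.lower_right p₁ hp₁).1, (h.lower_right p₂ (hp₁.trans hp)).1]
  exact this

/-- As the height grows the foot `p = ξ - 2 τ - ε` moves left. Feet below `q ε` are rib ends, the
others belong to the right foliation; a pair on different sides is compared through `q ε`. -/
lemma lowerTheta_mono (h : IsFissureData ε fp fm u₀ q r m g Mu κu Ml κl) {δ : ℝ}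
    (hδ : ExtendsBy ε fp fm q δ) {ξ τ₁ τ₂ p₁ p₂ : ℝ} (hτ₁ : -ε ≤ τ₁) (hτ : τ₁ ≤ τ₂) (hτ₂ : τ₂ ≤ ε)
    (e₁ : p₁ = ξ - 2 * τ₁ - ε) (e₂ : p₂ = ξ - 2 * τ₂ - ε) (hp₂ : q τ₂ ≤ p₂) (hp₁ : p₁ ≤ q ε + δ) :
    κl p₂ - 2 * deriv fm p₂ - (ε + ξ - p₂) * Ml p₂ ≤
      κl p₁ - 2 * deriv fm p₁ - (ε + ξ - p₁) * Ml p₁ := by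
  have hε := h.pos
  have hp : p₂ ≤ p₁ := by linarith
  have hqc := h.flow.continuous_q
  rcases le_total p₂ (q ε) with h2 | h2
  · obtain ⟨t₂, ht₂, rfl⟩ := intermediate_value_Icc hτ₂ hqc.continuousOn ⟨hp₂, h2⟩
    have hξ : ξ ≤ q t₂ + 2 * t₂ + ε := by linarith [ht₂.1]
    rcases le_total p₁ (q ε) with h1 | h1
    · obtain ⟨t₁, ht₁, rfl⟩ := intermediate_value_Icc ht₂.2 hqc.continuousOn ⟨hp, h1⟩
      exact h.lowerTheta_spine (by linarith [ht₂.1]) ht₁.1 ht₁.2 hξ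
    · exact (h.lowerTheta_spine (by linarith [ht₂.1]) ht₂.2 le_rfl hξ).trans
        (h.lowerTheta_right hδ le_rfl h1 hp₁ (by linarith) (by linarith))
  · exact h.lowerTheta_right hδ h2 hp hp₁ (by linarith) (by linarith)

/-- Mirror image: along `x₁ - x₂ = ξ` the derivative in direction `(1, 1)` changes with `t` at the
rate `(2 + r) g (ξ - ε - q)`, which is nonpositive when the line meets the rib not below the spine.
-/
lemma upperTheta_spine (h : IsFissureData ε fp fm u₀ q r m g Mu κu Ml κl) {ξ t₁ t₂ : ℝ}
    (ht₁ : -ε ≤ t₁) (ht : t₁ ≤ t₂) (ht₂ : t₂ ≤ ε) (hξ : ξ - ε ≤ q t₁) :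
    κu (q t₂ + 2 * t₂) + 2 * deriv fp (q t₂ + 2 * t₂) +
        (ε + ξ - (q t₂ + 2 * t₂)) * Mu (q t₂ + 2 * t₂) ≤
      κu (q t₁ + 2 * t₁) + 2 * deriv fp (q t₁ + 2 * t₁) +
        (ε + ξ - (q t₁ + 2 * t₁)) * Mu (q t₁ + 2 * t₁) := by
  have hqc := h.flow.continuous_q
  have hmc := h.flow.continuous_m
  have hκc := h.continuous_κu
  have hφc := h.contDiff_deriv_fp.continuous
  have hanti : AntitoneOn (fun t => κu (q t + 2 * t) + 2 * deriv fp (q t + 2 * t) +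
      (ε + ξ - (q t + 2 * t)) * m t) (Icc t₁ t₂) := by
    refine antitoneOn_of_hasDerivWithinAt_nonpos (f' := fun t =>
      (2 + r t) * g t * (ξ - ε - q t)) (convex_Icc _ _)
      (Continuous.continuousOn (by fun_prop)) (fun t ht => ?_) fun t ht => ?_
    · rw [interior_Icc] at ht ⊢
      have ht' : t ∈ Ico (-ε) ε := ⟨by linarith [ht.1], by linarith [ht.2]⟩
      have ht'' : t ∈ Icc (-ε) ε := ⟨ht'.1, ht'.2.le⟩
      have d1 := (h.hasDerivAt_κu _).comp t (h.flow.hasDerivAt_p t)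
      have d2 := ((h.hasDerivAt_deriv_fp _).comp t (h.flow.hasDerivAt_p t)).const_mul 2
      have d3 := ((h.flow.hasDerivAt_p t).const_sub (ε + ξ)).mul (h.flow.hasDerivAt_m t ht')
      refine (((d1.add d2).add d3).congr_deriv ?_).hasDerivWithinAt
      have h1 := h.flow.m_eq t
      rw [(h.upper_spine t ht'').1]
      linear_combination (-2 * (2 + r t)) * h1
    · rw [interior_Icc] at ht
      have ht'' : t ∈ Icc (-ε) ε := ⟨by linarith [ht.1], by linarith [ht.2]⟩
      have h1 := h.flow.strictMonoOn_q.monotoneOn ⟨ht₁, by linarith⟩ ht'' ht.1.le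
      exact mul_nonpos_of_nonneg_of_nonpos
        (mul_nonneg (h.flow.two_add_r_pos t).le (h.flow.g_pos t ht'').le) (by linarith)
  have := hanti (left_mem_Icc.mpr ht) (right_mem_Icc.mpr ht) ht
  rw [(h.upper_spine t₁ ⟨ht₁, ht.trans ht₂⟩).1, (h.upper_spine t₂ ⟨ht₁.trans ht, ht₂⟩).1]
  exact this

lemma upperTheta_left (h : IsFissureData ε fp fm u₀ q r m g Mu κu Ml κl) {δ : ℝ}
    (hδ : ExtendsBy ε fp fm q δ) {ξ p₁ p₂ : ℝ} (hp₁ : q (-ε) + 2 * (-ε) - δ ≤ p₁) (hp : p₁ ≤ p₂)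
    (hp₂ : p₂ ≤ q (-ε) + 2 * (-ε)) (h₂ : p₂ ≤ ε + ξ) (h₁ : ξ - p₁ ≤ 3 * ε) :
    κu p₂ + 2 * deriv fp p₂ + (ε + ξ - p₂) * Mu p₂ ≤
      κu p₁ + 2 * deriv fp p₁ + (ε + ξ - p₁) * Mu p₁ := by
  have hε := h.pos
  have hκc := h.continuous_κu
  have hφc := h.contDiff_deriv_fp.continuous
  have hψc := h.contDiff_deriv_fm.continuous
  have hanti : AntitoneOn (fun p => κu p + 2 * deriv fp p +
      (ε + ξ - p) * ((deriv fm (p + 2 * ε) - deriv fp p) / (2 * ε))) (Icc p₁ p₂) := by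
    refine antitoneOn_of_hasDerivWithinAt_nonpos (f' := fun p =>
      -2 * ((deriv fm (p + 2 * ε) - deriv fp p) / (2 * ε) - deriv (deriv fp) p) + (ε + ξ - p) *
        ((deriv (deriv fm) (p + 2 * ε) - deriv (deriv fp) p) / (2 * ε))) (convex_Icc _ _)
      (Continuous.continuousOn (by fun_prop)) (fun p hp => ?_) fun p hp => ?_
    · rw [interior_Icc] at hp
      have d1 : HasDerivAt (fun p => deriv fm (p + 2 * ε)) (deriv (deriv fm) (p + 2 * ε)) p :=
        (h.hasDerivAt_deriv_fm _).comp_add_const p (2 * ε)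
      have d2 := h.hasDerivAt_deriv_fp p
      have d3 := ((h.hasDerivAt_κu p).add (d2.const_mul 2)).add
        (((hasDerivAt_id p).const_sub (ε + ξ)).mul ((d1.sub d2).div_const (2 * ε)))
      refine (d3.congr_deriv ?_).hasDerivWithinAt
      rw [(h.upper_left p (hp.2.le.trans hp₂)).1]
      simp only [id, Pi.sub_apply]
      ring
    · rw [interior_Icc] at hp
      have h1 := hδ.left p ⟨by linarith [hp.1], by linarith [hp.2]⟩
      set l := (deriv fm (p + 2 * ε) - deriv fp p) / (2 * ε)
      have e : -2 * (l - deriv (deriv fp) p) + (ε + ξ - p) *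
          ((deriv (deriv fm) (p + 2 * ε) - deriv (deriv fp) p) / (2 * ε)) =
          -(((3 * ε - ξ + p) * (l - deriv (deriv fp) p) +
            (ε + ξ - p) * (l - deriv (deriv fm) (p + 2 * ε))) / (2 * ε)) := by
        field_simp
        ring
      rw [e, neg_nonpos]
      refine div_nonneg (add_nonneg (mul_nonneg ?_ ?_) (mul_nonneg ?_ ?_)) (by positivity) <;>
        linarith [hp.1, hp.2, h1.1, h1.2]
  have := hanti (left_mem_Icc.mpr hp) (right_mem_Icc.mpr hp) hp
  rw [(h.upper_left p₁ (hp.trans hp₂)).1, (h.upper_left p₂ hp₂).1]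
  exact this

lemma upperTheta_mono (h : IsFissureData ε fp fm u₀ q r m g Mu κu Ml κl) {δ : ℝ}
    (hδ : ExtendsBy ε fp fm q δ) {ξ τ₁ τ₂ p₁ p₂ : ℝ} (hτ₁ : -ε ≤ τ₁) (hτ : τ₁ ≤ τ₂) (hτ₂ : τ₂ ≤ ε)
    (e₁ : p₁ = ξ + 2 * τ₁ - ε) (e₂ : p₂ = ξ + 2 * τ₂ - ε) (hp : ξ - ε ≤ q τ₁)
    (hp₁ : q (-ε) + 2 * (-ε) - δ ≤ p₁) :
    κu p₂ + 2 * deriv fp p₂ + (ε + ξ - p₂) * Mu p₂ ≤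
      κu p₁ + 2 * deriv fp p₁ + (ε + ξ - p₁) * Mu p₁ := by
  have hε := h.pos
  have hp12 : p₁ ≤ p₂ := by linarith
  have hqc := h.flow.continuous_q
  have hpc : Continuous fun t => q t + 2 * t := by fun_prop
  have hq : MonotoneOn q (Icc (-ε) ε) := h.flow.strictMonoOn_q.monotoneOn
  rcases le_total (q (-ε) + 2 * (-ε)) p₁ with h1 | h1
  · obtain ⟨t₁, ht₁, rfl⟩ := intermediate_value_Icc hτ₁ hpc.continuousOn
      (show p₁ ∈ Icc (q (-ε) + 2 * (-ε)) (q τ₁ + 2 * τ₁) from ⟨h1, by linarith⟩)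
    simp only at e₁ hp12 hp₁ h1 ⊢
    have h2 := hq ⟨hτ₁, hτ.trans hτ₂⟩ ⟨hτ₁.trans hτ, hτ₂⟩ hτ
    obtain ⟨t₂, ht₂, rfl⟩ := intermediate_value_Icc (ht₁.2.trans hτ) hpc.continuousOn
      (show p₂ ∈ Icc (q t₁ + 2 * t₁) (q τ₂ + 2 * τ₂) from ⟨hp12, by linarith⟩)
    exact h.upperTheta_spine ht₁.1 ht₂.1 (ht₂.2.trans hτ₂) (by linarith [ht₁.2])
  · rcases le_total p₂ (q (-ε) + 2 * (-ε)) with h2 | h2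
    · exact h.upperTheta_left hδ hp₁ hp12 h2 (by linarith) (by linarith)
    · have h3 := hq ⟨hτ₁, hτ.trans hτ₂⟩ ⟨hτ₁.trans hτ, hτ₂⟩ hτ
      obtain ⟨t₂, ht₂, rfl⟩ := intermediate_value_Icc (hτ₁.trans hτ) hpc.continuousOn
        (show p₂ ∈ Icc (q (-ε) + 2 * (-ε)) (q τ₂ + 2 * τ₂) from ⟨h2, by linarith⟩)
      exact (h.upperTheta_spine le_rfl ht₂.1 (ht₂.2.trans hτ₂) (by linarith)).trans
        (h.upperTheta_left hδ hp₁ h1 le_rfl (by linarith) (by linarith))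

/-- Going up along `x₁ + x₂ = k`, the line can cross the spine only from right to left, because `q t
+ 2 t` increases. On the left the candidate is linear along it; on the right `lowerTheta_mono`
applies. -/
lemma antitoneOn_left (h : IsFissureData ε fp fm u₀ q r m g Mu κu Ml κl) {δ : ℝ}
    (hδ : ExtendsBy ε fp fm q δ) {k a b : ℝ}
    (hD : ∀ τ ∈ Icc a b, (k + -1 * τ, τ) ∈ trapezoid ε q δ) :
    AntitoneOn (fun τ => gluedDeriv ε fp fm q Mu κu Ml κl (k + -1 * τ, τ) (-1, 1))
      (Icc a b) := by
  have hstrip : ∀ τ ∈ Icc a b, τ ∈ Icc (-ε) ε := fun τ hτ => abs_le.mp (hD τ hτ).1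
  have hqc := h.flow.continuous_q
  have hU : ∀ τ, k + -1 * τ ≤ q τ + τ + ε →
      gluedDeriv ε fp fm q Mu κu Ml κl (k + -1 * τ, τ) (-1, 1) = κu (k - ε) := by
    intro τ hτ
    rw [gluedDeriv_eq_upperDeriv hτ, upperDeriv_apply,
      show k + -1 * τ + τ - ε = k - ε by ring]
    ring
  have hL : ∀ τ ∈ Icc a b, q τ + τ + ε ≤ k + -1 * τ →
      gluedDeriv ε fp fm q Mu κu Ml κl (k + -1 * τ, τ) (-1, 1) =
        κl (k - 2 * τ - ε) - 2 * deriv fm (k - 2 * τ - ε) -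
          (ε + k - (k - 2 * τ - ε)) * Ml (k - 2 * τ - ε) := by
    intro τ hτ h1
    rw [h.gluedDeriv_eq_lowerDeriv (hD τ hτ).1 h1, lowerDeriv_apply,
      show k + -1 * τ - τ - ε = k - 2 * τ - ε by ring]
    ring
  have hLL : ∀ τ₁ ∈ Icc a b, ∀ τ₂ ∈ Icc a b, τ₁ ≤ τ₂ → q τ₁ + τ₁ + ε ≤ k + -1 * τ₁ →
      q τ₂ + τ₂ + ε ≤ k + -1 * τ₂ →
      gluedDeriv ε fp fm q Mu κu Ml κl (k + -1 * τ₂, τ₂) (-1, 1) ≤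
        gluedDeriv ε fp fm q Mu κu Ml κl (k + -1 * τ₁, τ₁) (-1, 1) := by
    intro τ₁ h₁ τ₂ h₂ h12 l₁ l₂
    rw [hL τ₁ h₁ l₁, hL τ₂ h₂ l₂]
    have := (hD τ₁ h₁).2.2
    simp only at this
    exact h.lowerTheta_mono hδ (hstrip τ₁ h₁).1 h12 (hstrip τ₂ h₂).2 rfl rfl
      (by linarith) (by linarith)
  have hmono : ∀ τ₁ ∈ Icc a b, ∀ τ₂ ∈ Icc a b, τ₁ ≤ τ₂ → q τ₁ + 2 * τ₁ ≤ q τ₂ + 2 * τ₂ :=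
    fun τ₁ _ τ₂ _ h12 => h.flow.strictMono_p.monotone h12
  intro τ₁ h₁ τ₂ h₂ h12
  change gluedDeriv ε fp fm q Mu κu Ml κl (k + -1 * τ₂, τ₂) (-1, 1) ≤
    gluedDeriv ε fp fm q Mu κu Ml κl (k + -1 * τ₁, τ₁) (-1, 1)
  have hm := hmono τ₁ h₁ τ₂ h₂ h12
  rcases le_total (k + -1 * τ₁) (q τ₁ + τ₁ + ε) with l₁ | l₁
  · rw [hU τ₁ l₁, hU τ₂ (by linarith)]
  rcases le_total (k + -1 * τ₂) (q τ₂ + τ₂ + ε) with l₂ | l₂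
  -- At the crossing point both formulas hold, by the `C¹` fit, so the two monotone pieces can be
  -- chained.
  · obtain ⟨t, ht, hkt⟩ := intermediate_value_Icc h12
      (f := fun t => q t + t + ε - (k + -1 * t)) (Continuous.continuousOn (by fun_prop))
      (show (0 : ℝ) ∈ _ from ⟨by linarith, by linarith⟩)
    have ht' : t ∈ Icc a b := ⟨h₁.1.trans ht.1, ht.2.trans h₂.2⟩
    simp only at hkt
    have := hLL τ₁ h₁ t ht' ht.1 l₁ (by linarith)
    rwa [hU t (by linarith), ← hU τ₂ l₂] at this
  · exact hLL τ₁ h₁ τ₂ h₂ h12 l₁ l₂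

/-- Here the crossing is ruled by the monotonicity of `q` itself, and the linear side is the right
one. -/
lemma antitoneOn_right (h : IsFissureData ε fp fm u₀ q r m g Mu κu Ml κl) {δ : ℝ}
    (hδ : ExtendsBy ε fp fm q δ) {k a b : ℝ}
    (hD : ∀ τ ∈ Icc a b, (k + 1 * τ, τ) ∈ trapezoid ε q δ) :
    AntitoneOn (fun τ => gluedDeriv ε fp fm q Mu κu Ml κl (k + 1 * τ, τ) (1, 1))
      (Icc a b) := by
  have hstrip : ∀ τ ∈ Icc a b, τ ∈ Icc (-ε) ε := fun τ hτ => abs_le.mp (hD τ hτ).1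
  have hqc := h.flow.continuous_q
  have hL : ∀ τ ∈ Icc a b, q τ + τ + ε ≤ k + 1 * τ →
      gluedDeriv ε fp fm q Mu κu Ml κl (k + 1 * τ, τ) (1, 1) = κl (k - ε) := by
    intro τ hτ h1
    rw [h.gluedDeriv_eq_lowerDeriv (hD τ hτ).1 h1, lowerDeriv_apply,
      show k + 1 * τ - τ - ε = k - ε by ring]
    ring
  have hU : ∀ τ, k + 1 * τ ≤ q τ + τ + ε →
      gluedDeriv ε fp fm q Mu κu Ml κl (k + 1 * τ, τ) (1, 1) =
        κu (k + 2 * τ - ε) + 2 * deriv fp (k + 2 * τ - ε) +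
          (ε + k - (k + 2 * τ - ε)) * Mu (k + 2 * τ - ε) := by
    intro τ hτ
    rw [gluedDeriv_eq_upperDeriv hτ, upperDeriv_apply,
      show k + 1 * τ + τ - ε = k + 2 * τ - ε by ring]
    ring
  have hUU : ∀ τ₁ ∈ Icc a b, ∀ τ₂ ∈ Icc a b, τ₁ ≤ τ₂ → k + 1 * τ₁ ≤ q τ₁ + τ₁ + ε →
      k + 1 * τ₂ ≤ q τ₂ + τ₂ + ε →
      gluedDeriv ε fp fm q Mu κu Ml κl (k + 1 * τ₂, τ₂) (1, 1) ≤
        gluedDeriv ε fp fm q Mu κu Ml κl (k + 1 * τ₁, τ₁) (1, 1) := by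
    intro τ₁ h₁ τ₂ h₂ h12 l₁ l₂
    rw [hU τ₁ l₁, hU τ₂ l₂]
    have := (hD τ₁ h₁).2.1
    simp only at this
    exact h.upperTheta_mono hδ (hstrip τ₁ h₁).1 h12 (hstrip τ₂ h₂).2 rfl rfl
      (by linarith) (by linarith)
  intro τ₁ h₁ τ₂ h₂ h12
  change gluedDeriv ε fp fm q Mu κu Ml κl (k + 1 * τ₂, τ₂) (1, 1) ≤
    gluedDeriv ε fp fm q Mu κu Ml κl (k + 1 * τ₁, τ₁) (1, 1)
  have hm := h.flow.strictMonoOn_q.monotoneOn (hstrip τ₁ h₁) (hstrip τ₂ h₂) h12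
  rcases le_total (k + 1 * τ₂) (q τ₂ + τ₂ + ε) with l₂ | l₂
  · rcases le_total (k + 1 * τ₁) (q τ₁ + τ₁ + ε) with l₁ | l₁
    · exact hUU τ₁ h₁ τ₂ h₂ h12 l₁ l₂
    · obtain ⟨t, ht, hkt⟩ := intermediate_value_Icc h12
        (f := fun t => q t + t + ε - (k + 1 * t)) (Continuous.continuousOn (by fun_prop))
        (show (0 : ℝ) ∈ _ from ⟨by linarith, by linarith⟩)
      have ht' : t ∈ Icc a b := ⟨h₁.1.trans ht.1, ht.2.trans h₂.2⟩
      simp only at hkt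
      have := hUU t ht' τ₂ h₂ ht.2 (by linarith) l₂
      rwa [hL t ht' (by linarith), ← hL τ₁ h₁ l₁] at this
  · rw [hL τ₂ h₂ l₂, hL τ₁ h₁ (by linarith)]

lemma diagonallyConcaveOn_glued (h : IsFissureData ε fp fm u₀ q r m g Mu κu Ml κl) {δ : ℝ}
    (hδ : ExtendsBy ε fp fm q δ) :
    DiagonallyConcaveOn (trapezoid ε q δ) (glued ε fp fm q κu κl) := by
  have key : ∀ (s k : ℝ) (x y : ℝ × ℝ), x.1 = k + s * x.2 → y.1 = k + s * y.2 →
      segment ℝ x y ⊆ trapezoid ε q δ → ∀ τ ∈ uIcc x.2 y.2, (k + s * τ, τ) ∈ trapezoid ε q δ := by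
    intro s k x y hx hy hs τ hτ
    rw [← segment_eq_uIcc] at hτ
    obtain ⟨α, β, hα, hβ, hαβ, rfl⟩ := hτ
    refine hs ⟨α, β, hα, hβ, hαβ, Prod.ext ?_ rfl⟩
    simp only [Prod.fst_add, Prod.smul_fst, smul_eq_mul, hx, hy]
    linear_combination k * hαβ
  rintro x y (hxy | hxy) hs
  · have hx : x.1 = (x.1 - x.2) + 1 * x.2 := by ring
    have hy : y.1 = (x.1 - x.2) + 1 * y.2 := by linarith
    have hD := key 1 _ x y hx hy hs
    exact concaveOn_segment_of_line hx hy (h.concaveOn_line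
      (fun τ hτ => abs_le.mp (hD τ hτ).1) (h.antitoneOn_right hδ hD))
  · have hx : x.1 = (x.1 + x.2) + -1 * x.2 := by ring
    have hy : y.1 = (x.1 + x.2) + -1 * y.2 := by linarith
    have hD := key (-1) _ x y hx hy hs
    exact concaveOn_segment_of_line hx hy (h.concaveOn_line
      (fun τ hτ => abs_le.mp (hD τ hτ).1) (h.antitoneOn_left hδ hD))

end IsFissureData

/-! ### Extremal segments, the spine as a graph, and the candidate on each region -/

lemma snd_mem_of_mem_segment_upper {ε : ℝ} {x y : ℝ × ℝ} (hy : y.2 ≤ ε)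
    (hx : x ∈ segment ℝ y (y.1 + y.2 - ε, ε)) :
    x.1 + x.2 = y.1 + y.2 ∧ y.2 ≤ x.2 ∧ x.2 ≤ ε := by
  obtain ⟨α, β, hα, hβ, hαβ, rfl⟩ := hx
  obtain rfl : α = 1 - β := by linarith
  simp only [Prod.fst_add, Prod.smul_fst, Prod.snd_add, Prod.smul_snd, smul_eq_mul]
  refine ⟨by ring, ?_, ?_⟩ <;> nlinarith

lemma snd_mem_of_mem_segment_lower {ε : ℝ} {x y : ℝ × ℝ} (hy : -ε ≤ y.2)
    (hx : x ∈ segment ℝ y (y.1 - y.2 - ε, -ε)) :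
    x.1 - x.2 = y.1 - y.2 ∧ -ε ≤ x.2 ∧ x.2 ≤ y.2 := by
  obtain ⟨α, β, hα, hβ, hαβ, rfl⟩ := hx
  obtain rfl : α = 1 - β := by linarith
  simp only [Prod.fst_add, Prod.smul_fst, Prod.snd_add, Prod.smul_snd, smul_eq_mul]
  refine ⟨by ring, ?_, ?_⟩ <;> nlinarith

lemma mem_segment_of_mem_Icc {y z : ℝ × ℝ} {t : ℝ} (ht : t ∈ Icc (0 : ℝ) 1) :
    (1 - t) • y + t • z ∈ segment ℝ y z :=
  ⟨1 - t, t, by linarith [ht.2], ht.1, by ring, rfl⟩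

namespace IsSpineFlow

variable {ε : ℝ} {φ ψ : ℝ → ℝ} {u₀ : ℝ} {q r m g : ℝ → ℝ}

/-- The spine as the graph of a function of the first coordinate. -/
lemma exists_spine (h : IsSpineFlow ε φ ψ u₀ q r m g) (hε : 0 < ε) :
    ∃ T : ℝ → ℝ, Continuous T ∧ (∀ t ∈ Icc (-ε) ε, T (q t + t + ε) = t) ∧
      ∀ u ∈ Icc (q (-ε)) (q ε + ε + ε), T u ∈ Icc (-ε) ε ∧ q (T u) + T u + ε = u ∧
        HasDerivAt T (1 + r (T u))⁻¹ u := by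
  let U : ℝ → ℝ := fun t => q t + t + ε
  have hU : ∀ t, HasDerivAt U (1 + r t) t := fun t =>
    (((h.hasDerivAt_q t).add (hasDerivAt_id t)).add_const ε).congr_deriv (by ring)
  have hUm : StrictMono U := strictMono_of_deriv_pos fun t => by
    rw [(hU t).deriv]; exact h.one_add_r_pos t
  have hUc : Continuous U := continuous_iff_continuousAt.mpr fun t => (hU t).continuousAt
  -- Inverting on the doubled interval makes the heights `±ε` interior, so that `T` has two-sided
  -- derivatives at both ends of the spine.
  obtain ⟨T, hTc, hT, -⟩ := exists_continuous_leftInverse (a := -2 * ε) (b := 2 * ε) (by linarith)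
    hUc (hUm.strictMonoOn _)
  have hleft : ∀ v ∈ Icc (U (-2 * ε)) (U (2 * ε)), U (T v) = v := by
    intro v hv
    obtain ⟨t, ht, rfl⟩ := intermediate_value_Icc (by linarith) hUc.continuousOn hv
    rw [hT t ht]
  refine ⟨T, hTc, fun t ht => hT t ⟨by linarith [ht.1], by linarith [ht.2]⟩, fun u hu => ?_⟩
  have hu' : u ∈ Icc (U (-ε)) (U ε) := by
    have e1 : U (-ε) = q (-ε) := by simp [U]
    rw [e1]
    exact hu
  obtain ⟨t, ht, rfl⟩ := intermediate_value_Icc (by linarith) hUc.continuousOn hu'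
  have hTt : T (U t) = t := hT t ⟨by linarith [ht.1], by linarith [ht.2]⟩
  refine ⟨by rwa [hTt], by rw [hTt], ?_⟩
  refine HasDerivAt.of_local_left_inverse hTc.continuousAt (hU _) (h.one_add_r_pos _).ne' ?_
  have h1 : U (-2 * ε) < U t := hUm (by linarith [ht.1])
  have h2 : U t < U (2 * ε) := hUm (by linarith [ht.2])
  filter_upwards [isOpen_Ioo.mem_nhds ⟨h1, h2⟩] with v hv
  exact hleft v ⟨hv.1.le, hv.2.le⟩

end IsSpineFlow

namespace IsFissureData

variable {ε : ℝ} {fp fm : ℝ → ℝ} {u₀ : ℝ} {q r m g Mu κu Ml κl : ℝ → ℝ}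

lemma mem_endpoints (h : IsFissureData ε fp fm u₀ q r m g Mu κu Ml κl) :
    -ε ∈ Icc (-ε) ε ∧ (0 : ℝ) ∈ Icc (-ε) ε ∧ ε ∈ Icc (-ε) ε := by
  have := h.pos
  refine ⟨⟨?_, ?_⟩, ⟨?_, ?_⟩, ⟨?_, ?_⟩⟩ <;> linarith

lemma linearOnSegment_upper (h : IsFissureData ε fp fm u₀ q r m g Mu κu Ml κl) {y : ℝ × ℝ}
    (hy : y ∈ strip ε) (hs : y.1 ≤ q y.2 + y.2 + ε) :
    LinearOnSegment (glued ε fp fm q κu κl) y (y.1 + y.2 - ε, ε) := by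
  have hy2 : y.2 ∈ Icc (-ε) ε := abs_le.mp hy
  have key : ∀ x ∈ segment ℝ y (y.1 + y.2 - ε, ε), glued ε fp fm q κu κl x =
      fp (y.1 + y.2 - ε) - (ε - x.2) * κu (y.1 + y.2 - ε) := by
    intro x hx
    obtain ⟨h1, h2, h3⟩ := snd_mem_of_mem_segment_upper hy2.2 hx
    have h4 := h.flow.strictMono_p.monotone h2
    rw [glued_eq_upperPart (by linarith), upperPart, h1]
  intro t ht
  rw [key _ (mem_segment_of_mem_Icc ht), key _ (left_mem_segment _ _ _),
    key _ (right_mem_segment _ _ _)]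
  simp only [Prod.snd_add, Prod.smul_snd, smul_eq_mul]
  ring

lemma linearOnSegment_lower (h : IsFissureData ε fp fm u₀ q r m g Mu κu Ml κl) {y : ℝ × ℝ}
    (hy : y ∈ strip ε) (hs : q y.2 + y.2 + ε ≤ y.1) :
    LinearOnSegment (glued ε fp fm q κu κl) y (y.1 - y.2 - ε, -ε) := by
  have hy2 : y.2 ∈ Icc (-ε) ε := abs_le.mp hy
  have key : ∀ x ∈ segment ℝ y (y.1 - y.2 - ε, -ε), glued ε fp fm q κu κl x =
      fm (y.1 - y.2 - ε) + (ε + x.2) * κl (y.1 - y.2 - ε) := by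
    intro x hx
    obtain ⟨h1, h2, h3⟩ := snd_mem_of_mem_segment_lower hy2.1 hx
    have hx2 : x.2 ∈ Icc (-ε) ε := ⟨h2, h3.trans hy2.2⟩
    have h4 := h.flow.strictMonoOn_q.monotoneOn hx2 hy2 h3
    rw [h.glued_eq_lowerPart (abs_le.mpr hx2) (by linarith), lowerPart, h1]
  intro t ht
  rw [key _ (mem_segment_of_mem_Icc ht), key _ (left_mem_segment _ _ _),
    key _ (right_mem_segment _ _ _)]
  simp only [Prod.snd_add, Prod.smul_snd, smul_eq_mul]
  ring

lemma glued_upper_boundary (h : IsFissureData ε fp fm u₀ q r m g Mu κu Ml κl) {x : ℝ × ℝ}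
    (hx : x.2 = ε) : glued ε fp fm q κu κl x = fp x.1 := by
  have hε := h.pos
  rcases le_total x.1 (q x.2 + x.2 + ε) with hs | hs
  · rw [glued_eq_upperPart hs, upperPart, hx]
    simp
  · have hxs : x ∈ strip ε := by simp [strip, hx, abs_of_pos hε]
    rw [h.glued_eq_lowerPart hxs hs, lowerPart, (h.lower_right _ (by rw [hx] at hs ⊢; linarith)).2,
      hx, show x.1 - ε - ε + 2 * ε = x.1 by ring]
    field_simp
    ring

lemma glued_lower_boundary (h : IsFissureData ε fp fm u₀ q r m g Mu κu Ml κl) {x : ℝ × ℝ}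
    (hx : x.2 = -ε) : glued ε fp fm q κu κl x = fm x.1 := by
  have hε := h.pos
  rcases le_total x.1 (q x.2 + x.2 + ε) with hs | hs
  · rw [glued_eq_upperPart hs, upperPart, (h.upper_left _ (by rw [hx] at hs ⊢; linarith)).2,
      hx, show x.1 + -ε - ε + 2 * ε = x.1 by ring]
    field_simp
    ring
  · have hxs : x ∈ strip ε := by simp [strip, hx, abs_of_pos hε]
    rw [h.glued_eq_lowerPart hxs hs, lowerPart, hx]
    simp

lemma eqOn_candidateL (h : IsFissureData ε fp fm u₀ q r m g Mu κu Ml κl) (v : ℝ) :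
    EqOn (glued ε fp fm q κu κl) (candidateL ε fp fm) (regionL ε v (q (-ε) - ε)) := by
  rintro x ⟨hx, -, hv⟩
  have hε := h.pos
  have hx2 : x.2 ∈ Icc (-ε) ε := abs_le.mp hx
  have h1 := h.flow.strictMono_p.monotone hx2.1
  rw [glued_eq_upperPart (by linarith), upperPart, candidateL, (h.upper_left _ (by linarith)).2,
    show x.1 + x.2 - ε + 2 * ε = x.1 + x.2 + ε by ring]
  field_simp
  ring

lemma eqOn_candidateR (h : IsFissureData ε fp fm u₀ q r m g Mu κu Ml κl) (v : ℝ) :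
    EqOn (glued ε fp fm q κu κl) (candidateR ε fp fm) (regionR ε (q ε + ε) v) := by
  rintro x ⟨hx, hv, -⟩
  have hε := h.pos
  have hx2 : x.2 ∈ Icc (-ε) ε := abs_le.mp hx
  have h1 := h.flow.strictMonoOn_q.monotoneOn hx2 h.mem_endpoints.2.2 hx2.2
  rw [h.glued_eq_lowerPart hx (by linarith), lowerPart, candidateR,
    (h.lower_right _ (by linarith)).2, show x.1 - x.2 - ε + 2 * ε = x.1 - x.2 + ε by ring]
  field_simp
  ring

/-- All regions of the proposition lie in the trapezoid and contain with each point its extremal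
segment to the boundary; the alternative of local linearity in both directions is never needed. -/
lemma isBellmanCandidate_of_eqOn (h : IsFissureData ε fp fm u₀ q r m g Mu κu Ml κl) {δ : ℝ}
    (hδ : ExtendsBy ε fp fm q δ) {Ω : Set (ℝ × ℝ)} {B : ℝ × ℝ → ℝ} (hΩ : Ω ⊆ trapezoid ε q δ)
    (hB : EqOn (glued ε fp fm q κu κl) B Ω)
    (hext : ∀ y ∈ Ω,
      (y.1 ≤ q y.2 + y.2 + ε ∧ segment ℝ y (y.1 + y.2 - ε, ε) ⊆ Ω) ∨
      (q y.2 + y.2 + ε ≤ y.1 ∧ segment ℝ y (y.1 - y.2 - ε, -ε) ⊆ Ω)) :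
    IsBellmanCandidate ε fp fm Ω B where
  subset_strip := fun x hx => (hΩ hx).1
  concave := fun x y hxy hs =>
    (h.diagonallyConcaveOn_glued hδ x y hxy (hs.trans hΩ)).congr fun z hz => hB (hs hz)
  boundary_upper := fun x hx hx2 => by rw [← hB hx, h.glued_upper_boundary hx2]
  boundary_lower := fun x hx hx2 => by rw [← hB hx, h.glued_lower_boundary hx2]
  extremal := fun y hy => by
    have key : ∀ z, segment ℝ y z ⊆ Ω → LinearOnSegment (glued ε fp fm q κu κl) y z →
        LinearOnSegment B y z := by
      intro z hz hl t ht
      rw [← hB (hz (mem_segment_of_mem_Icc ht)), ← hB (hz (left_mem_segment _ _ _)),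
        ← hB (hz (right_mem_segment _ _ _))]
      exact hl t ht
    left
    rcases hext y hy with ⟨h1, h2⟩ | ⟨h1, h2⟩
    · refine ⟨_, Or.inl rfl, Or.inr ?_, h2, key _ h2 (h.linearOnSegment_upper (hΩ hy).1 h1)⟩
      simp
    · refine ⟨_, Or.inr rfl, Or.inl ?_, h2, key _ h2 (h.linearOnSegment_lower (hΩ hy).1 h1)⟩
      simp

lemma regionL_extremal (h : IsFissureData ε fp fm u₀ q r m g Mu κu Ml κl) {v : ℝ} {y : ℝ × ℝ}
    (hy : y ∈ regionL ε v (q (-ε) - ε)) :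
    y.1 ≤ q y.2 + y.2 + ε ∧ segment ℝ y (y.1 + y.2 - ε, ε) ⊆ regionL ε v (q (-ε) - ε) := by
  have hy2 : y.2 ∈ Icc (-ε) ε := abs_le.mp hy.1
  have h1 := h.flow.strictMono_p.monotone hy2.1
  refine ⟨by linarith [hy.2.2], fun x hx => ?_⟩
  obtain ⟨e, h2, h3⟩ := snd_mem_of_mem_segment_upper hy2.2 hx
  refine ⟨abs_le.mpr ⟨hy2.1.trans h2, h3⟩, ?_⟩
  rw [e]
  exact hy.2

lemma regionR_extremal (h : IsFissureData ε fp fm u₀ q r m g Mu κu Ml κl) {v : ℝ} {y : ℝ × ℝ}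
    (hy : y ∈ regionR ε (q ε + ε) v) :
    q y.2 + y.2 + ε ≤ y.1 ∧ segment ℝ y (y.1 - y.2 - ε, -ε) ⊆ regionR ε (q ε + ε) v := by
  have hy2 : y.2 ∈ Icc (-ε) ε := abs_le.mp hy.1
  have h1 := h.flow.strictMonoOn_q.monotoneOn hy2 h.mem_endpoints.2.2 hy2.2
  refine ⟨by linarith [hy.2.1], fun x hx => ?_⟩
  obtain ⟨e, h2, h3⟩ := snd_mem_of_mem_segment_lower hy2.1 hx
  refine ⟨abs_le.mpr ⟨h2, h3.trans hy2.2⟩, ?_⟩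
  rw [e]
  exact hy.2

lemma upperSide_of_mem_upperRib (h : IsFissureData ε fp fm u₀ q r m g Mu κu Ml κl) {T : ℝ → ℝ}
    {u : ℝ} (hu : q (T u) + T u + ε = u) {x : ℝ × ℝ} (hx : x ∈ upperRib ε T u) :
    x.1 ≤ q x.2 + x.2 + ε := by
  have h1 := h.flow.strictMono_p.monotone hx.2.1
  linarith [hx.1]

lemma lowerSide_of_mem_lowerRib (h : IsFissureData ε fp fm u₀ q r m g Mu κu Ml κl) {T : ℝ → ℝ}
    {u : ℝ} (hT : T u ∈ Icc (-ε) ε) (hu : q (T u) + T u + ε = u) {x : ℝ × ℝ}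
    (hx : x ∈ lowerRib ε T u) : q x.2 + x.2 + ε ≤ x.1 := by
  have h1 := h.flow.strictMonoOn_q.monotoneOn ⟨hx.2.1, hx.2.2.trans hT.2⟩ hT hx.2.2
  linarith [hx.1]

lemma herringbone_extremal (h : IsFissureData ε fp fm u₀ q r m g Mu κu Ml κl) {T : ℝ → ℝ}
    {a b : ℝ} (hT : ∀ u ∈ Icc a b, T u ∈ Icc (-ε) ε ∧ q (T u) + T u + ε = u) {y : ℝ × ℝ}
    (hy : y ∈ regionHerringbone ε T a b) :
    (y.1 ≤ q y.2 + y.2 + ε ∧ segment ℝ y (y.1 + y.2 - ε, ε) ⊆ regionHerringbone ε T a b) ∨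
    (q y.2 + y.2 + ε ≤ y.1 ∧ segment ℝ y (y.1 - y.2 - ε, -ε) ⊆ regionHerringbone ε T a b) := by
  simp only [regionHerringbone, mem_iUnion₂] at hy
  obtain ⟨u, hu, hy | hy⟩ := hy
  · refine Or.inl ⟨h.upperSide_of_mem_upperRib (hT u hu).2 hy, fun x hx => ?_⟩
    obtain ⟨e, h2, h3⟩ := snd_mem_of_mem_segment_upper hy.2.2 hx
    exact mem_iUnion₂.mpr ⟨u, hu, Or.inl ⟨e.trans hy.1, hy.2.1.trans h2, h3⟩⟩
  · refine Or.inr ⟨h.lowerSide_of_mem_lowerRib (hT u hu).1 (hT u hu).2 hy, fun x hx => ?_⟩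
    obtain ⟨e, h2, h3⟩ := snd_mem_of_mem_segment_lower hy.2.1 hx
    exact mem_iUnion₂.mpr ⟨u, hu, Or.inr ⟨e.trans hy.1, h2, h3.trans hy.2.2⟩⟩

lemma regionL_subset (h : IsFissureData ε fp fm u₀ q r m g Mu κu Ml κl) {δ : ℝ} (hδ : 0 < δ) :
    regionL ε (q (-ε) - ε - δ) (q (-ε) - ε) ⊆ trapezoid ε q δ := by
  rintro x ⟨hx, h1, h2⟩
  have hx2 : x.2 ∈ Icc (-ε) ε := abs_le.mp hx
  have h3 := h.flow.strictMonoOn_q.monotoneOn h.mem_endpoints.1 h.mem_endpoints.2.2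
    h.mem_endpoints.1.2
  exact ⟨hx, by linarith, by linarith [hx2.1]⟩

lemma regionR_subset (h : IsFissureData ε fp fm u₀ q r m g Mu κu Ml κl) {δ : ℝ} (hδ : 0 < δ) :
    regionR ε (q ε + ε) (q ε + ε + δ) ⊆ trapezoid ε q δ := by
  rintro x ⟨hx, h1, h2⟩
  have hx2 : x.2 ∈ Icc (-ε) ε := abs_le.mp hx
  have h3 := h.flow.strictMonoOn_q.monotoneOn h.mem_endpoints.1 h.mem_endpoints.2.2
    h.mem_endpoints.1.2
  exact ⟨hx, by linarith [hx2.1], by linarith⟩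

lemma regionHerringbone_subset (h : IsFissureData ε fp fm u₀ q r m g Mu κu Ml κl) {δ : ℝ}
    (hδ : 0 < δ) {T : ℝ → ℝ} {a b : ℝ}
    (hT : ∀ u ∈ Icc a b, T u ∈ Icc (-ε) ε ∧ q (T u) + T u + ε = u) :
    regionHerringbone ε T a b ⊆ trapezoid ε q δ := by
  intro x hx
  simp only [regionHerringbone, mem_iUnion₂] at hx
  obtain ⟨u, hu, hx⟩ := hx
  obtain ⟨hTu, hu'⟩ := hT u hu
  have h1 := h.flow.strictMono_p.monotone hTu.1
  have h2 := h.flow.strictMonoOn_q.monotoneOn hTu h.mem_endpoints.2.2 hTu.2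
  have h3 := h.flow.strictMonoOn_q.monotoneOn h.mem_endpoints.1 hTu hTu.1
  rcases hx with ⟨e, h4, h5⟩ | ⟨e, h4, h5⟩
  · exact ⟨abs_le.mpr ⟨hTu.1.trans h4, h5⟩, by linarith, by linarith⟩
  · exact ⟨abs_le.mpr ⟨h4, h5.trans hTu.2⟩, by linarith, by linarith⟩

/-- The value of the candidate at the point of the spine of height `t`. -/
lemma spineValue_eq (h : IsFissureData ε fp fm u₀ q r m g Mu κu Ml κl) {t : ℝ}
    (ht : t ∈ Icc (-ε) ε) :
    (ε ^ 2 - t ^ 2) / (2 * ε) * (2 * ε * m t + deriv fp (q t + 2 * t) + deriv fm (q t)) +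
        ((ε + t) * fp (q t + 2 * t) + (ε - t) * fm (q t)) / (2 * ε) =
      fp (q t + 2 * t) - (ε - t) * κu (q t + 2 * t) ∧
    (ε ^ 2 - t ^ 2) / (2 * ε) * (2 * ε * m t + deriv fp (q t + 2 * t) + deriv fm (q t)) +
        ((ε + t) * fp (q t + 2 * t) + (ε - t) * fm (q t)) / (2 * ε) =
      fm (q t) + (ε + t) * κl (q t) := by
  have hε := h.pos
  rw [(h.upper_spine t ht).2, (h.lower_spine t ht).2]
  constructor <;> field_simp <;> ring

end IsFissureData

/-! ### The root `u₊`, the neighbouring foliations and the equation of the spine -/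

lemma iteratedDeriv_two_eq (f : ℝ → ℝ) : iteratedDeriv 2 f = deriv (deriv f) := by
  rw [iteratedDeriv_succ, iteratedDeriv_one]

/-- The function whose root is `u₊` is strictly increasing near `u₀` when `ε` is small. -/
lemma exists_strictMonoOn_rootFunction {φ ψ : ℝ → ℝ} (hφ : ContDiff ℝ 2 φ)
    (hψ : ContDiff ℝ 1 ψ) (u₀ : ℝ) (h1 : deriv ψ u₀ < deriv φ u₀) :
    ∃ ε₀ > 0, ∀ ε : ℝ, 0 < ε → ε < ε₀ →
      StrictMonoOn (fun u => φ (u + ε) - ψ (u - ε) - 2 * ε * deriv φ (u + ε))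
        (Icc (u₀ - ε) (u₀ + 3 * ε)) ∧
      ∀ x ∈ Icc (u₀ - 4 * ε) (u₀ + 4 * ε), ∀ y ∈ Icc (u₀ - 4 * ε) (u₀ + 4 * ε),
        deriv ψ y < deriv φ x := by
  have hφ1 : ContDiff ℝ 1 (deriv φ) := by
    have : ContDiff ℝ (1 + 1) φ := by simpa [one_add_one_eq_two] using hφ
    exact (contDiff_succ_iff_deriv.mp this).2.2
  have hφc := hφ1.continuous
  have hφ2 : Continuous (deriv (deriv φ)) := hφ1.continuous_deriv le_rfl
  have hψ1 : Continuous (deriv ψ) := hψ.continuous_deriv le_rfl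
  -- The derivative of the root function with its arguments made independent: at `(u₀, u₀, 0)` it is
  -- `φ' - ψ' > 0`, and it stays positive nearby. All arguments below lie within `4 ε` of `u₀`,
  -- hence the `ρ / 5`.
  let k : ℝ × ℝ × ℝ → ℝ := fun w => deriv φ w.1 - deriv ψ w.2.1 - 2 * w.2.2 * deriv (deriv φ) w.1
  have hk : Continuous k := by fun_prop
  have h0 : 0 < k (u₀, u₀, 0) := by simpa [k] using h1
  obtain ⟨ρ, hρ, hball⟩ := Metric.eventually_nhds_iff.mp
    (hk.continuousAt.eventually (lt_mem_nhds h0))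
  have hpos : ∀ x y e : ℝ, |x - u₀| < ρ → |y - u₀| < ρ → |e| < ρ → 0 < k (x, y, e) := by
    intro x y e hx hy he
    apply hball
    simp only [Prod.dist_eq, Real.dist_eq, sub_zero, max_lt_iff]
    exact ⟨hx, hy, he⟩
  refine ⟨ρ / 5, by positivity, fun ε hε hερ => ⟨?_, fun x hx y hy => ?_⟩⟩
  · have hd : ∀ u, HasDerivAt (fun u => φ (u + ε) - ψ (u - ε) - 2 * ε * deriv φ (u + ε))
        (k (u + ε, u - ε, ε)) u := by
      intro u
      have d1 : HasDerivAt (fun u => φ (u + ε)) (deriv φ (u + ε)) u :=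
        ((hφ.differentiable (by simp)) _).hasDerivAt.comp_add_const u ε
      have d2 : HasDerivAt (fun u => ψ (u - ε)) (deriv ψ (u - ε)) u :=
        ((hψ.differentiable (by simp)) _).hasDerivAt.comp_sub_const u ε
      have d3 : HasDerivAt (fun u => deriv φ (u + ε)) (deriv (deriv φ) (u + ε)) u :=
        ((hφ1.differentiable (by simp)) _).hasDerivAt.comp_add_const u ε
      exact (d1.sub d2).sub (d3.const_mul (2 * ε))
    refine strictMonoOn_of_deriv_pos (convex_Icc _ _)
      (fun u _ => (hd u).continuousAt.continuousWithinAt) fun u hu => ?_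
    rw [interior_Icc] at hu
    rw [(hd u).deriv]
    apply hpos <;> rw [abs_lt] <;> constructor <;> linarith [hu.1, hu.2]
  · have := hpos x y 0 (by rw [abs_lt]; constructor <;> linarith [hx.1, hx.2])
      (by rw [abs_lt]; constructor <;> linarith [hy.1, hy.2]) (by simpa using hρ)
    simpa [k] using this

lemma exists_isFissureData {fp fm : ℝ → ℝ} (hfp : ContDiff ℝ (⊤ : ℕ∞) fp)
    (hfm : ContDiff ℝ (⊤ : ℕ∞) fm) {u₀ : ℝ} (h1 : deriv fp u₀ = deriv fm u₀)
    (h2 : deriv (deriv fm) u₀ < deriv (deriv fp) u₀)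
    (h3 : 0 < deriv (deriv (deriv fp)) u₀) :
    ∃ ε₀ > 0, ∀ ε : ℝ, 0 < ε → ε < ε₀ → ∃ q r m g Mu κu Ml κl,
      IsFissureData ε fp fm u₀ q r m g Mu κu Ml κl := by
  have hφ : ContDiff ℝ (⊤ : ℕ∞) (deriv fp) := by simpa using hfp.iterate_deriv 1
  have hψ : ContDiff ℝ (⊤ : ℕ∞) (deriv fm) := by simpa using hfm.iterate_deriv 1
  obtain ⟨ε₀, hε₀, H⟩ := exists_isSpineFlow hφ hψ u₀ h2 h3
  refine ⟨ε₀, hε₀, fun ε hε hεε => ?_⟩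
  obtain ⟨q, r, m, g, h⟩ := H ε hε hεε
  have hfp2 : ContDiff ℝ 2 fp := contDiff_infty.mp hfp 2
  have hfm2 : ContDiff ℝ 2 fm := contDiff_infty.mp hfm 2
  obtain ⟨Mu, κu, a1, a2, a3, a4⟩ := h.exists_upper_slope hfp2 hfm2 hε h1
  obtain ⟨Ml, κl, b1, b2, b3, b4⟩ := h.exists_lower_slope hfp2 hfm2 hε h1
  exact ⟨q, r, m, g, Mu, κu, Ml, κl, hε, hfp, hfm, h, fun t ht => h.two_mul_m hε
    (hφ.differentiable (by simp)) (hψ.differentiable (by simp)) h1 ht,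
    a1, a2, a3, a4, b1, b2, b3, b4⟩

namespace IsFissureData

variable {ε : ℝ} {fp fm : ℝ → ℝ} {u₀ : ℝ} {q r m g Mu κu Ml κl : ℝ → ℝ}

lemma rootFunction_eq_zero (h : IsFissureData ε fp fm u₀ q r m g Mu κu Ml κl) :
    deriv fp (q ε + ε + ε) - deriv fm (q ε + ε - ε) -
      2 * ε * deriv (deriv fp) (q ε + ε + ε) = 0 := by
  have e1 := h.two_mul_m ε h.mem_endpoints.2.2
  have e2 := h.flow.m_eq ε
  have e3 : q ε + ε + ε = q ε + 2 * ε := by ring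
  rw [sub_self, zero_mul, zero_add] at e2
  rw [add_sub_cancel_right, e3, ← e2]
  linarith

/-- On the left both inequalities are strict at the junction and persist by continuity. On the right
`D₊` vanishes at the junction, and its sign comes from the monotonicity of the root function. -/
lemma exists_extendsBy (h : IsFissureData ε fp fm u₀ q r m g Mu κu Ml κl)
    (hroot : StrictMonoOn
      (fun u => deriv fp (u + ε) - deriv fm (u - ε) - 2 * ε * deriv (deriv fp) (u + ε))
      (Icc (u₀ - ε) (u₀ + 3 * ε)))
    (hlt : ∀ x ∈ Icc (u₀ - 4 * ε) (u₀ + 4 * ε), ∀ y ∈ Icc (u₀ - 4 * ε) (u₀ + 4 * ε),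
      deriv (deriv fm) y < deriv (deriv fp) x) :
    ∃ δ > 0, ExtendsBy ε fp fm q δ := by
  have hε := h.pos
  obtain ⟨hl, -, hr⟩ := h.mem_endpoints
  have hqr := abs_le.mp (h.flow.abs_q_sub_le ε hr)
  set a := q (-ε) + 2 * (-ε) with ha
  have haq : a + 2 * ε = q (-ε) := by rw [ha]; ring
  have hφ := h.contDiff_deriv_fp.continuous
  have hψ := h.contDiff_deriv_fm.continuous
  have hφ' : Continuous (deriv (deriv fp)) := continuous_iff_continuousAt.mpr fun p => by
    have := (h.contDiff_deriv_fp.iterate_deriv 1).continuous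
    simpa using this.continuousAt
  have hψ' : Continuous (deriv (deriv fm)) := continuous_iff_continuousAt.mpr fun p => by
    have := (h.contDiff_deriv_fm.iterate_deriv 1).continuous
    simpa using this.continuousAt
  have hma : (deriv fm (a + 2 * ε) - deriv fp a) / (2 * ε) = m (-ε) := by
    rw [haq, div_eq_iff (by positivity)]
    linarith [h.two_mul_m _ hl]
  have e1 : ∀ᶠ p in 𝓝 a, deriv (deriv fp) p < (deriv fm (p + 2 * ε) - deriv fp p) / (2 * ε) := by
    refine Continuous.continuousAt (by fun_prop) |>.eventually_lt
      (Continuous.continuousAt (by fun_prop)) ?_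
    rw [hma, h.flow.m_eq, ← ha]
    have := mul_pos (show 0 < ε - -ε by linarith) (h.flow.g_pos _ hl)
    linarith
  have e2 : ∀ᶠ p in 𝓝 a, deriv (deriv fm) (p + 2 * ε) <
      (deriv fm (p + 2 * ε) - deriv fp p) / (2 * ε) := by
    refine Continuous.continuousAt (by fun_prop) |>.eventually_lt
      (Continuous.continuousAt (by fun_prop)) ?_
    rw [hma, haq]
    exact h.flow.lt_m _ hl
  obtain ⟨ρ, hρ, hball⟩ := Metric.eventually_nhds_iff.mp (e1.and e2)
  -- The bound by `ε` keeps the arguments inside the intervals of `hroot` and `hlt`.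
  refine ⟨min (ρ / 2) ε, by positivity, fun p hp => ?_, fun p hp => ?_⟩
  · have h1 : dist p a < ρ := by
      rw [Real.dist_eq, abs_lt]
      have := min_le_left (ρ / 2) ε
      constructor <;> linarith [hp.1, hp.2]
    exact ⟨(hball h1).1.le, (hball h1).2.le⟩
  · have hmin := min_le_right (ρ / 2) ε
    have h1 : deriv (deriv fp) (p + 2 * ε) ≤
        (deriv fp (p + 2 * ε) - deriv fm p) / (2 * ε) := by
      rw [le_div_iff₀ (by positivity)]
      have h2 := hroot.monotoneOn (a := q ε + ε) (b := p + ε)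
        ⟨by linarith, by linarith⟩ ⟨by linarith [hp.1], by linarith [hp.2]⟩ (by linarith [hp.1])
      simp only [h.rootFunction_eq_zero] at h2
      rw [add_sub_cancel_right, show p + ε + ε = p + 2 * ε by ring] at h2
      linarith
    -- `D₋ ≥ 0` follows from `D₊ ≥ 0`, since `f₋''(p) < f₊''(p + 2 ε)`.
    exact ⟨h1, (hlt (p + 2 * ε) ⟨by linarith [hp.1], by linarith [hp.2]⟩ p
      ⟨by linarith [hp.1], by linarith [hp.2]⟩).le.trans h1⟩

/-- `T' = 1 / (1 + r)` with `r ≥ 0`, and `r` vanishes only at height `-ε`; the slope is 1 only at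
the left end. -/
lemma isSWFissure (h : IsFissureData ε fp fm u₀ q r m g Mu κu Ml κl) {T : ℝ → ℝ}
    (hTc : Continuous T) (hT1 : ∀ t ∈ Icc (-ε) ε, T (q t + t + ε) = t)
    (hT2 : ∀ u ∈ Icc (q (-ε)) (q ε + ε + ε), T u ∈ Icc (-ε) ε ∧ q (T u) + T u + ε = u ∧
        HasDerivAt T (1 + r (T u))⁻¹ u) :
    IsSWFissure ε T (q (-ε)) (q ε + ε + ε) := by
  have hε := h.pos
  obtain ⟨hl, -, hr⟩ := h.mem_endpoints
  have hq : q (-ε) < q ε := h.flow.strictMonoOn_q hl hr (by linarith)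
  have hab : q (-ε) < q ε + ε + ε := by linarith
  have hTl : T (q (-ε)) = -ε := by simpa using hT1 _ hl
  have hTr : T (q ε + ε + ε) = ε := hT1 _ hr
  have hd : ∀ u ∈ Icc (q (-ε)) (q ε + ε + ε),
      derivWithin T (Icc (q (-ε)) (q ε + ε + ε)) u = (1 + r (T u))⁻¹ := fun u hu =>
    (hT2 u hu).2.2.hasDerivWithinAt.derivWithin (uniqueDiffOn_Icc hab u hu)
  have hrn : ∀ u ∈ Icc (q (-ε)) (q ε + ε + ε), 0 ≤ r (T u) := fun u hu =>
    h.flow.r_nonneg hε (hT2 u hu).1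
  refine ⟨⟨hab, ?_, fun u hu => abs_le.mpr (hT2 u hu).1, fun u hu => ?_, ?_⟩, hTl, hTr,
    fun u hu => ?_⟩
  · have : ContDiffOn ℝ (0 + 1) T (Icc (q (-ε)) (q ε + ε + ε)) := by
      rw [contDiffOn_succ_iff_derivWithin (uniqueDiffOn_Icc hab)]
      refine ⟨fun u hu => (hT2 u hu).2.2.differentiableAt.differentiableWithinAt, by simp, ?_⟩
      rw [contDiffOn_zero]
      refine ContinuousOn.congr (Continuous.continuousOn ?_) hd
      exact (continuous_const.add (h.flow.continuous_r.comp hTc)).inv₀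
        fun u => (h.flow.one_add_r_pos _).ne'
    simpa using this
  · rw [hd u hu, abs_inv]
    refine inv_le_one_of_one_le₀ ?_
    rw [abs_of_pos (h.flow.one_add_r_pos _)]
    linarith [hrn u hu]
  · refine (finite_singleton (q (-ε))).subset ?_
    rintro u ⟨hu, hu1⟩
    rw [hd u hu, abs_inv, inv_eq_one, abs_of_pos (h.flow.one_add_r_pos _)] at hu1
    obtain ⟨h1, h2, -⟩ := hT2 u hu
    have h3 : T u = -ε := by
      rcases h1.1.eq_or_lt with h4 | h4
      · exact h4.symm
      · linarith [h.flow.r_pos ⟨h4, h1.2⟩]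
    rw [h3] at h2
    rw [mem_singleton_iff]
    linarith
  · obtain ⟨h1, h2, -⟩ := hT2 u ⟨hu.1.le, hu.2.le⟩
    rw [abs_lt]
    constructor
    · refine lt_of_le_of_ne h1.1 fun h3 => ?_
      rw [← h3] at h2
      linarith [hu.1]
    · refine lt_of_le_of_ne h1.2 fun h3 => ?_
      rw [h3] at h2
      linarith [hu.2]

/-- For `t < ε` the denominator is at least `(ε - t) D₋ > 0`, even at the lower end, so only `t = 0`
and `t = ε` are excluded. Cross-multiplied, the equation is `r_mul` times `ε - t`. -/
lemma solvesLeftSpineODE (h : IsFissureData ε fp fm u₀ q r m g Mu κu Ml κl) {T : ℝ → ℝ}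
    (hT2 : ∀ u ∈ Icc (q (-ε)) (q ε + ε + ε), T u ∈ Icc (-ε) ε ∧ q (T u) + T u + ε = u ∧
        HasDerivAt T (1 + r (T u))⁻¹ u) :
    SolvesLeftSpineODE ε fp fm T (q (-ε)) (q ε + ε + ε) {u₀ + ε, q ε + ε + ε} := by
  rintro u ⟨hu, hu'⟩
  simp only [mem_insert_iff, mem_singleton_iff, not_or] at hu'
  obtain ⟨ht, hut, hd⟩ := hT2 u hu
  generalize T u = t at *
  have h0 : t ≠ 0 := by
    rintro rfl
    rw [h.flow.q_zero] at hut
    exact hu'.1 (by linarith)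
  have htε : t < ε := lt_of_le_of_ne ht.2 (by rintro rfl; exact hu'.2 hut.symm)
  have e1 : u + t - ε = q t + 2 * t := by linarith
  have e2 : u - t - ε = q t := by linarith
  have hm : (deriv fp (q t + 2 * t) - deriv fm (q t)) / (2 * t) = m t := by
    rw [div_eq_iff (by simpa using h0)]
    linarith [h.two_mul_m t ht]
  have hp : DLp ε fp fm u t = (ε - t) * g t := by
    rw [DLp, iteratedDeriv_two_eq, e1, e2, hm, h.flow.m_eq]
    ring
  have hmm : DLm ε fp fm u t = m t - deriv (deriv fm) (q t) := by
    rw [DLm, iteratedDeriv_two_eq, e1, e2, hm]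
  have hpos : 0 < m t - deriv (deriv fm) (q t) := sub_pos.mpr (h.flow.lt_m t ht)
  have hnonneg : 0 ≤ (ε - t) * g t := mul_nonneg (by linarith) (h.flow.g_pos t ht).le
  have hden : 0 < odeDen ε fp fm u t := by
    rw [odeDen, hp, hmm]
    exact add_pos_of_pos_of_nonneg (mul_pos (by linarith) hpos)
      (mul_nonneg (by linarith [ht.1]) hnonneg)
  refine ⟨h0, hp ▸ hnonneg, hmm ▸ hpos.le, hden.ne', ?_⟩
  refine (hd.congr_deriv ?_).hasDerivWithinAt
  have hr := h.flow.one_add_r_pos t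
  rw [eq_div_iff hden.ne', inv_mul_eq_iff_eq_mul₀ hr.ne', odeDen, odeNum, hp, hmm]
  linear_combination -(ε - t) * h.flow.r_mul t ht

end IsFissureData

end BellmanStrip

/-! ### Assembly of the proposition -/

open BellmanStrip in
theorem proposition200101 (fp fm : ℝ → ℝ) (hfp : ContDiff ℝ (⊤ : ℕ∞) fp)
    (hfm : ContDiff ℝ (⊤ : ℕ∞) fm) (u₀ : ℝ)
    (h1 : deriv fp u₀ = deriv fm u₀)
    (h2 : iteratedDeriv 2 fm u₀ < iteratedDeriv 2 fp u₀)
    (h3 : 0 < iteratedDeriv 3 fp u₀) :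
    ∃ ε₀ > 0, ∀ ε : ℝ, 0 < ε → ε < ε₀ →
      ∃ up : ℝ,
        -- the root `u₊`, unique in the interval `(u₀, u₀ + 2 ε)`
        (∀ u : ℝ, (u ∈ Set.Ioo u₀ (u₀ + 2 * ε) ∧
            deriv fp (u + ε) - deriv fm (u - ε) - 2 * ε * iteratedDeriv 2 fp (u + ε) = 0) ↔
          u = up) ∧
        ∃ (vm : ℝ) (T : ℝ → ℝ),
          -- the fissure
          BellmanStrip.IsSWFissure ε T (vm + ε) (up + ε) ∧
          BellmanStrip.SolvesLeftSpineODE ε fp fm T (vm + ε) (up + ε) {u₀ + ε, up + ε} ∧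
          T (u₀ + ε) = 0 ∧ T (up + ε) = ε ∧ T (vm + ε) = -ε ∧ vm < u₀ - ε ∧
          ∃ (A : ℝ → ℝ) (B : ℝ × ℝ → ℝ),
            -- the candidate on the fissure
            BellmanStrip.IsSpineValue ε fp fm T (vm + ε) (up + ε) A ∧
            BellmanStrip.IsHerringboneFunction ε fp fm T A (vm + ε) (up + ε) B ∧
            BellmanStrip.IsBellmanCandidate ε fp fm
              (BellmanStrip.regionHerringbone ε T (vm + ε) (up + ε)) B ∧
            -- gluing with the simple foliations on both sides
            ∃ δ > 0,
              BellmanStrip.IsBellmanCandidate ε fp fm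
                (BellmanStrip.regionR ε up (up + δ)) (BellmanStrip.candidateR ε fp fm) ∧
              BellmanStrip.IsBellmanCandidate ε fp fm
                (BellmanStrip.regionL ε (vm - δ) vm) (BellmanStrip.candidateL ε fp fm) ∧
              ∃ G : ℝ × ℝ → ℝ,
                Set.EqOn G (BellmanStrip.candidateL ε fp fm)
                  (BellmanStrip.regionL ε (vm - δ) vm) ∧
                Set.EqOn G B (BellmanStrip.regionHerringbone ε T (vm + ε) (up + ε)) ∧
                Set.EqOn G (BellmanStrip.candidateR ε fp fm)
                  (BellmanStrip.regionR ε up (up + δ)) ∧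
                ContDiffOn ℝ 1 G
                  (BellmanStrip.regionL ε (vm - δ) vm ∪
                    BellmanStrip.regionHerringbone ε T (vm + ε) (up + ε) ∪
                    BellmanStrip.regionR ε up (up + δ)) ∧
                BellmanStrip.IsBellmanCandidate ε fp fm
                  (BellmanStrip.regionL ε (vm - δ) vm ∪
                    BellmanStrip.regionHerringbone ε T (vm + ε) (up + ε) ∪
                    BellmanStrip.regionR ε up (up + δ)) G := by
  have h2' : deriv (deriv fm) u₀ < deriv (deriv fp) u₀ := by
    simpa only [iteratedDeriv_two_eq] using h2
  have h3' : 0 < deriv (deriv (deriv fp)) u₀ := by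
    rwa [iteratedDeriv_succ, iteratedDeriv_two_eq] at h3
  have hφ : ContDiff ℝ (⊤ : ℕ∞) (deriv fp) := by simpa using hfp.iterate_deriv 1
  have hψ : ContDiff ℝ (⊤ : ℕ∞) (deriv fm) := by simpa using hfm.iterate_deriv 1
  obtain ⟨e₁, he₁, H₁⟩ := exists_strictMonoOn_rootFunction
    (contDiff_infty.mp hφ 2) (hψ.of_le (by exact_mod_cast le_top)) u₀ h2'
  obtain ⟨e₂, he₂, H₂⟩ := exists_isFissureData hfp hfm h1 h2' h3'
  refine ⟨min e₁ e₂, lt_min he₁ he₂, fun ε hε hεe => ?_⟩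
  obtain ⟨hroot, hlt⟩ := H₁ ε hε (hεe.trans_le (min_le_left _ _))
  obtain ⟨q, r, m, g, Mu, κu, Ml, κl, h⟩ := H₂ ε hε (hεe.trans_le (min_le_right _ _))
  obtain ⟨δ, hδ0, hδ⟩ := h.exists_extendsBy hroot hlt
  obtain ⟨T, hTc, hT1, hT2⟩ := h.flow.exists_spine hε
  obtain ⟨hl, hz, hr⟩ := h.mem_endpoints
  have hT3 : ∀ u ∈ Icc (q (-ε)) (q ε + ε + ε), T u ∈ Icc (-ε) ε ∧ q (T u) + T u + ε = u :=
    fun u hu => ⟨(hT2 u hu).1, (hT2 u hu).2.1⟩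
  have hq0 := h.flow.q_zero
  have hqr := abs_le.mp (h.flow.abs_q_sub_le ε hr)
  have hql : q (-ε) < u₀ := hq0 ▸ h.flow.strictMonoOn_q hl hz (by linarith)
  have hsw := h.isSWFissure hTc hT1 hT2
  have hmem : q ε + ε ∈ Ioo u₀ (u₀ + 2 * ε) := ⟨by linarith, by linarith⟩
  -- `u₊` and `v₋` are read off the rib ends at heights `ε` and `-ε`, using `u = q + t + ε` and the
  -- shift by `ε` between spine and roots.
  refine ⟨q ε + ε, fun u => ⟨fun ⟨hu, hu0⟩ => ?_, ?_⟩, q (-ε) - ε, T, ?_⟩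
  · rw [iteratedDeriv_two_eq] at hu0
    exact hroot.injOn ⟨by linarith [hu.1], by linarith [hu.2]⟩
      ⟨by linarith [hmem.1], by linarith [hmem.2]⟩ (hu0.trans h.rootFunction_eq_zero.symm)
  · rintro rfl
    rw [iteratedDeriv_two_eq]
    exact ⟨hmem, h.rootFunction_eq_zero⟩
  have hT0 : T (u₀ + ε) = 0 := by simpa [hq0] using hT1 0 hz
  rw [sub_add_cancel]
  set G := glued ε fp fm q κu κl with hG
  have hHB := h.regionHerringbone_subset hδ0 hT3
  have hL := h.regionL_subset hδ0
  have hR := h.regionR_subset hδ0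
  refine ⟨hsw, h.solvesLeftSpineODE hT2, hT0, hsw.right_end, hsw.left_end, by linarith,
    -- The spine value written through `m`: it is continuous across `T = 0`, and `2 T m = f₊' - f₋'`
    -- turns it into the required formula elsewhere.
    fun u => (ε ^ 2 - T u ^ 2) / (2 * ε) * (2 * ε * m (T u) + deriv fp (q (T u) + 2 * T u) +
        deriv fm (q (T u))) +
      ((ε + T u) * fp (q (T u) + 2 * T u) + (ε - T u) * fm (q (T u))) / (2 * ε), G,
    ⟨?_, fun u hu hTu => ?_⟩, fun u hu => ⟨fun hTu x hx => ?_, fun hTu x hx => ?_⟩,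
    h.isBellmanCandidate_of_eqOn hδ hHB (fun _ _ => rfl)
      fun y hy => h.herringbone_extremal hT3 hy,
    δ, hδ0,
    h.isBellmanCandidate_of_eqOn hδ hR (h.eqOn_candidateR _)
      fun y hy => Or.inr (h.regionR_extremal hy),
    h.isBellmanCandidate_of_eqOn hδ hL (h.eqOn_candidateL _)
      fun y hy => Or.inl (h.regionL_extremal hy),
    G, h.eqOn_candidateL _, fun _ _ => rfl, h.eqOn_candidateR _, ?_, ?_⟩
  · have := h.flow.continuous_q
    have := h.flow.continuous_m
    have := hφ.continuous
    have := hψ.continuous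
    have := hfp.continuous
    have := hfm.continuous
    exact Continuous.continuousOn (by fun_prop)
  · obtain ⟨ht, hut⟩ := hT3 u hu
    have e1 : u + T u - ε = q (T u) + 2 * T u := by linarith
    have e2 : u - T u - ε = q (T u) := by linarith
    have hm := h.two_mul_m _ ht
    beta_reduce
    rw [e1, e2]
    generalize T u = t at *
    generalize q t + 2 * t = p at hm ⊢
    field_simp
    linear_combination (ε ^ 2 - t ^ 2) * ε * hm
  · obtain ⟨ht, hut⟩ := hT3 u hu
    have e1 : u + T u - ε = q (T u) + 2 * T u := by linarith
    have hx1 : x.1 + x.2 - ε = q (T u) + 2 * T u := by linarith [hx.1]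
    have hne : ε - T u ≠ 0 := (sub_pos.mpr hTu).ne'
    beta_reduce
    rw [hG, IsFissureData.glued_eq_upperPart (h.upperSide_of_mem_upperRib hut hx), upperPart, hx1, e1,
      (h.spineValue_eq ht).1]
    field_simp
    ring
  · obtain ⟨ht, hut⟩ := hT3 u hu
    have e1 : u - T u - ε = q (T u) := by linarith
    have hx1 : x.1 - x.2 - ε = q (T u) := by linarith [hx.1]
    have hne : ε + T u ≠ 0 := by linarith
    have hxs : x ∈ strip ε := abs_le.mpr ⟨hx.2.1, hx.2.2.trans ht.2⟩
    beta_reduce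
    rw [hG, h.glued_eq_lowerPart hxs (h.lowerSide_of_mem_lowerRib ht hut hx), lowerPart, hx1, e1,
      (h.spineValue_eq ht).2]
    field_simp
    ring
  · exact h.contDiffOn_glued.mono fun x hx =>
      (union_subset (union_subset hL hHB) hR hx).1
  · refine h.isBellmanCandidate_of_eqOn hδ (union_subset (union_subset hL hHB) hR)
      (fun _ _ => rfl) ?_
    rintro y ((hy | hy) | hy)
    · obtain ⟨a1, a2⟩ := h.regionL_extremal hy
      exact Or.inl ⟨a1, fun x hx => Or.inl (Or.inl (a2 hx))⟩
    · rcases h.herringbone_extremal hT3 hy with ⟨a1, a2⟩ | ⟨a1, a2⟩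
      · exact Or.inl ⟨a1, fun x hx => Or.inl (Or.inr (a2 hx))⟩
      · exact Or.inr ⟨a1, fun x hx => Or.inl (Or.inr (a2 hx))⟩
    · obtain ⟨a1, a2⟩ := h.regionR_extremal hy
      exact Or.inr ⟨a1, fun x hx => Or.inr (a2 hx)⟩
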